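/- Representations of quivers are finite-dimensional over $\mathbb{C}$. For a quiver $Q$ and a dimension vector $\alpha$, a point $V\in\operatorname{Rep}(Q,\alpha)=\bigoplus_{a}\operatorname{Hom}(\mathbb{C}^{\alpha_{ta}},\mathbb{C}^{\alpha_{ha}})$ is called generic if its orbit under $\operatorname{GL}(\alpha)=\prod_x\operatorname{GL}(\alpha_x)$ is (Zariski) dense; $\alpha$ is prehomogeneous if a generic point exists. A list $\alpha_1,\dots,\alpha_t$ of dimension vectors is the generic (canonical) decomposition of the prehomogeneous dimension vector $\alpha$ if the generic representation of dimension vector $\alpha$ is a direct sum of indecomposable representations of dimension vectors $\alpha_1,\dots,\alpha_t$. Let $n\ge 4$, and let $Q$ be a quiver of type $\mathbb{D}_n$, arbitrarily oriented, with vertices $1,\dots,n$ and with exactly one arrow between $i$ and $i+1$ for $1\le i\le n-2$ and one arrow between $2$ and $n$. Let $\alpha\in\mathbb{N}^n$. Assume first that the last arrow is $2\to n$. **The $\mathbb{A}_{n-1}$ diagram.** Consider the $\mathbb{A}_{n-1}$ quiver on the vertices $1,\dots,n-1$. Draw for each $i\le n-1$ a column of $\alpha_i$ vertically consecutive dots,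 the columns ordered from left to right, where columns $i$ and $i+1$ are aligned at the bottom if the arrow is $i\to i+1$ and at the top if it is $i\leftarrow i+1$. Connect horizontally neighbouring dots. Each connected horizontal component represents the indecomposable of dimension $1$ on the vertices of its dots and $0$ elsewhere. **The procedure for $\mathbb{D}_n$.** 1. Set aside the indecomposables of the diagram with dimension $0$ at vertex $2$. The others, ordered from top to bottom, are divided by a horizontal line into two classes by their dimension at vertex $1$. Those below the line form the first class: they have dimension $1$ at vertex $1$ if the arrow is $1\to 2$, and $0$ if it is $1\leftarrow 2$. Those above the line form the second class. 2. Place $\alpha_n$ symbols $\circ$ (copies of the simple $S_n$), one per row, starting from the line and moving downwards (past the last indecomposable of the first class if necessary), and draw a second horizontal line below the last $\circ$. 3. Move the indecomposables of the second class, in order from the top of the diagram, and add their dimension vectors to successive rows, starting with the row just above the bottom line and going up one row each time. Stop as soon as (a) the top line is reached, or (b) there are no more indecomposables of the second class, or (c) there is a non-zero morphism from the indecomposable of the second class to be moved to the indecomposable of the first class in the row where it would be placed (if that row contains one). 4. Output: the indecomposables set aside in step 1, the indecomposables of the second class that were not moved, and the indecomposables of the first class below the bottom line, all unchanged (with dimension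 $0$ at vertex $n$); and, for each row between the two lines, the sum of the dimension vectors in this row, with dimension $1$ at vertex $n$. If the last arrow is $n\to 2$ instead, apply the procedure to the opposite quiver of $Q$, with the same $\alpha$. **Theorem.** The indecomposables of the $\mathbb{A}_{n-1}$ diagram are the generic decomposition of $(\alpha_1,\dots,\alpha_{n-1})$ for the $\mathbb{A}_{n-1}$ quiver, and the output of the procedure is the generic decomposition of $\alpha$ for the $\mathbb{D}_n$ quiver $Q$. (In particular every $\alpha$ is prehomogeneous.) -/

import Mathlib

/-- A quiver with vertex set `X` and set of arrows `A`: every arrow has a tail and a head. -/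
structure QuiverData (X A : Type) where
  tail : A → X
  head : A → X

/-! ### Representations -/

/-- A finite-dimensional complex representation of a quiver. -/
structure QRep {X A : Type} (Q : QuiverData X A) where
  space : X → Type
  [addCommGroup : ∀ x, AddCommGroup (space x)]
  [module : ∀ x, Module ℂ (space x)]
  [finiteDimensional : ∀ x, FiniteDimensional ℂ (space x)]
  map : ∀ a : A, space (Q.tail a) →ₗ[ℂ] space (Q.head a)

attribute [instance] QRep.addCommGroup QRep.module QRep.finiteDimensional

namespace QRep

variable {X A : Type} {Q : QuiverData X A}

/-- The dimension vector of a representation. -/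
noncomputable def dimVector (V : QRep Q) : X → ℕ := fun x => Module.finrank ℂ (V.space x)

/-- Morphisms of representations. -/
structure Hom (V W : QRep Q) where
  app : ∀ x, V.space x →ₗ[ℂ] W.space x
  comm : ∀ a, app (Q.head a) ∘ₗ V.map a = W.map a ∘ₗ app (Q.tail a)

/-- Isomorphisms of representations. -/
structure Iso (V W : QRep Q) where
  app : ∀ x, V.space x ≃ₗ[ℂ] W.space x
  comm : ∀ a v, app (Q.head a) (V.map a v) = W.map a (app (Q.tail a) v)

/-- There is a non-zero morphism from `V` to `W`. -/
def HasNonzeroHom (V W : QRep Q) : Prop := ∃ φ : Hom V W, ∃ x, φ.app x ≠ 0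

/-- The zero representation, up to isomorphism. -/
def IsZero (V : QRep Q) : Prop := ∀ x, Subsingleton (V.space x)

/-- The direct sum of two representations. -/
def prod (V W : QRep Q) : QRep Q where
  space x := V.space x × W.space x
  map a := (V.map a).prodMap (W.map a)

/-- The direct sum of a finite family of representations. -/
def directSum {ι : Type} [Finite ι] (M : ι → QRep Q) : QRep Q where
  space x := ∀ i, (M i).space x
  map a := LinearMap.pi fun i => (M i).map a ∘ₗ LinearMap.proj i

/-- A representation is indecomposable if it is non-zero and in every decomposition into a direct
sum of two representations one of the two is zero. -/
def Indecomposable (V : QRep Q) : Prop :=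
  ¬ V.IsZero ∧ ∀ M N : QRep Q, Nonempty (Iso V (M.prod N)) → M.IsZero ∨ N.IsZero

/-- `V` is a direct sum of indecomposable representations whose dimension vectors are the entries
of the list `l`, with multiplicity. -/
def DecomposesAs (V : QRep Q) (l : List (X → ℕ)) : Prop :=
  ∃ M : Fin l.length → QRep Q,
    (∀ i, (M i).Indecomposable ∧ (M i).dimVector = l.get i) ∧ Nonempty (Iso V (directSum M))

end QRep

/-! ### The representation space and generic representations -/

/-- `Rep(Q, α)`: a matrix of size `α (head a) × α (tail a)` for every arrow `a`. -/
abbrev RepSpace {X A : Type} (Q : QuiverData X A) (α : X → ℕ) : Type :=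
  ∀ a : A, Matrix (Fin (α (Q.head a))) (Fin (α (Q.tail a))) ℂ

namespace RepSpace

variable {X A : Type} {Q : QuiverData X A} {α : X → ℕ}

/-- The representation on the spaces `ℂ ^ (α x)` given by a point of `Rep(Q, α)`. -/
noncomputable def toQRep (V : RepSpace Q α) : QRep Q where
  space x := Fin (α x) → ℂ
  map a := (V a).mulVecLin

/-- The action of `GL(α) = ∏ x, GL(α x)` on `Rep(Q, α)` by change of basis at each vertex. -/
noncomputable def act (g : ∀ x, GL (Fin (α x)) ℂ) (V : RepSpace Q α) : RepSpace Q α :=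
  fun a => (g (Q.head a)).val * V a * ((g (Q.tail a))⁻¹).val

/-- The value at a point of `Rep(Q, α)` of a polynomial in the matrix entries. -/
noncomputable def evalPoly
    (f : MvPolynomial (Σ a : A, Fin (α (Q.head a)) × Fin (α (Q.tail a))) ℂ)
    (V : RepSpace Q α) : ℂ :=
  MvPolynomial.eval (fun e => V e.1 e.2.1 e.2.2) f

/-- `V` is generic: its `GL(α)`-orbit is (Zariski) dense in `Rep(Q, α)`, that is, only the zero
polynomial function vanishes on the orbit. -/
def IsGeneric (V : RepSpace Q α) : Prop :=
  ∀ f : MvPolynomial (Σ a : A, Fin (α (Q.head a)) × Fin (α (Q.tail a))) ℂ,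
    (∀ g : ∀ x, GL (Fin (α x)) ℂ, evalPoly f (act g V) = 0) → f = 0

end RepSpace

/-- The list `l` is the generic (canonical) decomposition of the dimension vector `α`: there are
generic representations of dimension vector `α` (so `α` is prehomogeneous), and they are direct
sums of indecomposable representations with dimension vectors the entries of `l`. -/
def IsGenericDecomposition {X A : Type} (Q : QuiverData X A) (α : X → ℕ)
    (l : List (X → ℕ)) : Prop :=
  (∃ V : RepSpace Q α, V.IsGeneric) ∧
    ∀ V : RepSpace Q α, V.IsGeneric → V.toQRep.DecomposesAs l

/-! ### Quivers of type A and D -/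

/-- The quiver of type `A` with vertices `0, …, m` (from left to right): the arrow between `i` and
`i + 1` points to the right if `o i = true` and to the left if `o i = false`. -/
def typeA {m : ℕ} (o : Fin m → Bool) : QuiverData (Fin (m + 1)) (Fin m) where
  tail i := if o i then i.castSucc else i.succ
  head i := if o i then i.succ else i.castSucc

/-- The quiver of type `D_n`, `n = k + 4`. The vertices `1, …, n` are numbered `0, …, n - 1` here.
The vertices `0, …, n - 2` form the quiver `typeA o`; the remaining arrow `Sum.inr ()` joins the
vertices number `1` and `n - 1` (that is, the vertices `2` and `n`), and points from
`2` to `n` if `s = true` and from `n` to `2` if `s = false`. -/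
def typeD {k : ℕ} (o : Fin (k + 2) → Bool) (s : Bool) :
    QuiverData (Fin (k + 4)) (Fin (k + 2) ⊕ Unit) where
  tail
    | Sum.inl e => ((typeA o).tail e).castSucc
    | Sum.inr _ => if s then (1 : Fin (k + 3)).castSucc else Fin.last (k + 3)
  head
    | Sum.inl e => ((typeA o).head e).castSucc
    | Sum.inr _ => if s then Fin.last (k + 3) else (1 : Fin (k + 3)).castSucc

/-! ### The diagram in type A -/

section Diagram

variable {m : ℕ} (o : Fin m → Bool) (d : Fin (m + 1) → ℕ)

/-- Rows of the diagram are numbered by integers, from top to bottom. Column `i` consists of `d i`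
consecutive dots, the highest of which is in row `topRow o d i`. Two neighbouring columns are
aligned at the bottom if the arrow between them points to the right, and at the top if it points
to the left. -/
def topRow : Fin (m + 1) → ℤ :=
  Fin.induction (motive := fun _ => ℤ) 0
    (fun i t => if o i then t + (d i.castSucc : ℤ) - (d i.succ : ℤ) else t)

/-- There is a dot in row `r` and column `i`. -/
def IsDot (r : ℤ) (i : Fin (m + 1)) : Prop :=
  topRow o d i ≤ r ∧ r < topRow o d i + (d i : ℤ)

instance (r : ℤ) (i : Fin (m + 1)) : Decidable (IsDot o d r i) :=
  inferInstanceAs (Decidable (_ ∧ _))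

/-- The rows of the dots in column `i`, from top to bottom. -/
def columnRows (i : Fin (m + 1)) : List ℤ :=
  (List.range (d i)).map fun j => topRow o d i + (j : ℤ)

/-- The dimension vector of the indecomposable which is given by the connected horizontal component
of the dot in row `r` and column `i`. -/
def component (r : ℤ) (i : Fin (m + 1)) : Fin (m + 1) → ℕ :=
  fun j => if ∀ l ∈ Finset.Icc (min i j) (max i j), IsDot o d r l then 1 else 0

/-- All indecomposables of the diagram; each connected horizontal component is listed once, at its
leftmost dot. -/
def diagramA : List (Fin (m + 1) → ℕ) :=
  (List.finRange (m + 1)).flatMap fun i =>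
    ((columnRows o d i).filter fun r => ∀ j : Fin (m + 1), j.val + 1 = i.val → ¬ IsDot o d r j).map
      fun r => component o d r i

end Diagram

/-! ### The procedure in type D -/

/-- The point of `Rep(Q, β)` all of whose matrix entries are `1`. If `Q` is of type `A` and `β` is
the indicator function of an interval, this is the indecomposable representation with dimension
vector `β`; for `β = 0` it is the zero representation. -/
def thinRep {X A : Type} (Q : QuiverData X A) (β : X → ℕ) : RepSpace Q β :=
  fun _ => Matrix.of fun _ _ => 1

section Procedure

variable {k : ℕ} (o : Fin (k + 2) → Bool) (d : Fin (k + 3) → ℕ)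

/-- The indecomposables of the diagram with dimension `0` at vertex `2`. -/
def outerPart : List (Fin (k + 3) → ℕ) :=
  (diagramA o d).filter fun β => β 1 = 0

/-- The indecomposables of the diagram with dimension `1` at vertex `2`, from top to bottom. -/
def innerPart : List (Fin (k + 3) → ℕ) :=
  (columnRows o d 1).map fun r => component o d r 1

/-- The indecomposables of the first class, under the horizontal line, from top to bottom: those
with dimension `1` at vertex `1` if the arrow is `1 → 2`, and with dimension `0` if it is
`1 ← 2`. -/
def firstClass : List (Fin (k + 3) → ℕ) :=
  (innerPart o d).filter fun β => β 0 = if o 0 then 1 else 0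

/-- The indecomposables of the second class, over the horizontal line, from top to bottom. -/
def secondClass : List (Fin (k + 3) → ℕ) :=
  (innerPart o d).filter fun β => β 0 = if o 0 then 0 else 1

open scoped Classical in
/-- Moving the indecomposables of the second class. The first list consists of the rows between the
two horizontal lines, from bottom to top; the second one of the indecomposables of the second class
which have not been moved yet, from top to bottom. The result is the list of rows after all moves
and the list of indecomposables of the second class which are not moved. -/
noncomputable def moveSecondClass : List (Fin (k + 3) → ℕ) → List (Fin (k + 3) → ℕ) →
    List (Fin (k + 3) → ℕ) × List (Fin (k + 3) → ℕ)
  | [], W => ([], W)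
  | v :: R, [] => (v :: R, [])
  | v :: R, w :: W =>
    if (thinRep (typeA o) w).toQRep.HasNonzeroHom (thinRep (typeA o) v).toQRep then
      (v :: R, w :: W)
    else
      ((v + w) :: (moveSecondClass R W).1, (moveSecondClass R W).2)

/-- The rows between the two horizontal lines before the moves, from top to bottom, without their
symbols `∘`: there are `c` of them, and the `j`-th one contains the `j`-th indecomposable of the
first class, or none (the zero vector) if there are fewer than `j`. -/
def middleRows (c : ℕ) : List (Fin (k + 3) → ℕ) :=
  (List.range c).map fun j => (firstClass o d).getD j 0

/-- The result of the procedure for the orientation `2 → n`, with dimension vector `d` on the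
vertices `1, …, n - 1` and dimension `c` at the vertex `n`. -/
noncomputable def procedureD (c : ℕ) : List (Fin (k + 4) → ℕ) :=
  let moved := moveSecondClass o (middleRows o d c).reverse (secondClass o d)
  (outerPart o d ++ moved.2 ++ (firstClass o d).drop c).map
      (fun β => Fin.snoc (α := fun _ => ℕ) β 0) ++
    moved.1.map (fun β => Fin.snoc (α := fun _ => ℕ) β 1)

end Procedure

/-- The result of the procedure for an arbitrary orientation and dimension vector: if the arrow
between `2` and `n` is `n → 2`, the procedure is applied to the opposite quiver. -/
noncomputable def genericDecompositionD {k : ℕ} (o : Fin (k + 2) → Bool) (s : Bool)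
    (α : Fin (k + 4) → ℕ) : List (Fin (k + 4) → ℕ) :=
  procedureD (if s then o else fun i => !(o i)) (Fin.init (α := fun _ => ℕ) α)
    (α (Fin.last (k + 3)))

/-! The orbit of a representation without self-extensions contains the complement of a hypersurface
(`RepSpace.exists_polynomial_of_rigid`). So if bricks have vanishing Ext among themselves,
self-extensions included, and their dimension vectors add up to `α`, their direct sum is generic;
every generic point is isomorphic to it, since its dense orbit meets that complement
(`IsRigidList.isGenericDecomposition`). Bricks are indecomposable, so it remains to realise both
outputs as an `IsRigidList` and to add up dimensions (`diagramA_sum`, `procedureD_sum`).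

In type A, Ext between two components of the diagram is governed by one scalar equation per arrow.
The alignment of neighbouring columns lets these be solved recursively, from left to right or from
right to left according to which component lies lower (`thinExtVanishes_of_isRowSupport`).

In type D with arrow `2 → n`, each summand consists of at most two thin representations of type A
and a space of dimension at most one at `n` (`pairRep`). If the target lives at `n`, the last arrow
adds one equation for each thin part of the source present at vertex `2`. Such an equation can be
corrected by a morphism, non-zero at vertex `2`, to a thin part of the target; if the source lives
at `n`, the free scalar there settles one more (`extVanishes_pairRep`). Within a class lower
components map to higher ones (`thinHomAt_of_le`). The two classes fill the rows in opposite
vertical orders, so between any two rows one of the two parts maps in the required direction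
(`exists_rows_moveSecondClass`). Morphisms from the first class to the second vanish
(`isThinHom_eq_zero`), and stop rule (c) excludes the other direction in a combined row, which makes
the row a brick. When (c) does stop the procedure, the morphism it finds composes to morphisms from
all unmoved components to all remaining rows. The orientation `n → 2` follows by duality. -/

/-! ### Extensions, bricks and duality -/

/-- The opposite quiver. -/
def QuiverData.op {X A : Type} (Q : QuiverData X A) : QuiverData X A where
  tail := Q.head
  head := Q.tail

namespace QRep

variable {X A : Type} {Q : QuiverData X A}

/-- `Ext¹(V, W) = 0`. -/
def ExtVanishes (V W : QRep Q) : Prop :=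
  ∀ η : ∀ a, V.space (Q.tail a) →ₗ[ℂ] W.space (Q.head a),
    ∃ f : ∀ x, V.space x →ₗ[ℂ] W.space x,
      ∀ a v, f (Q.head a) (V.map a v) - W.map a (f (Q.tail a) v) = η a v

/-- A brick is a non-zero representation all of whose endomorphisms are scalars. -/
def IsBrick (V : QRep Q) : Prop :=
  ¬ V.IsZero ∧ ∀ f : Hom V V, ∃ c : ℂ, ∀ x v, f.app x v = c • v

/-- The inverse of an isomorphism. -/
def Iso.symm {V W : QRep Q} (e : Iso V W) : Iso W V where
  app x := (e.app x).symm
  comm a v := by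
    rw [LinearEquiv.symm_apply_eq, e.comm, LinearEquiv.apply_symm_apply]

/-- The composition of isomorphisms. -/
def Iso.trans {U V W : QRep Q} (e : Iso U V) (e' : Iso V W) : Iso U W where
  app x := (e.app x).trans (e'.app x)
  comm a v := by simp [e.comm, e'.comm]

theorem DecomposesAs.of_iso {V W : QRep Q} {l : List (X → ℕ)} (e : Iso V W)
    (h : W.DecomposesAs l) : V.DecomposesAs l := by
  obtain ⟨M, hM, ⟨e'⟩⟩ := h
  exact ⟨M, hM, ⟨e.trans e'⟩⟩

theorem ExtVanishes.of_iso {V W : QRep Q} (e : Iso V W) (h : ExtVanishes W W) :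
    ExtVanishes V V := by
  intro η
  obtain ⟨f, hf⟩ := h fun a =>
    (e.app (Q.head a)).toLinearMap ∘ₗ η a ∘ₗ (e.app (Q.tail a)).symm.toLinearMap
  refine ⟨fun x => (e.app x).symm.toLinearMap ∘ₗ f x ∘ₗ (e.app x).toLinearMap, fun a v => ?_⟩
  have := hf a (e.app _ v)
  simp only [LinearMap.comp_apply, LinearEquiv.coe_coe, LinearEquiv.symm_apply_apply] at this ⊢
  apply (e.app (Q.head a)).injective
  rw [map_sub, LinearEquiv.apply_symm_apply, e.comm, e.comm, LinearEquiv.apply_symm_apply]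
  exact this

/-- Ext is additive in both arguments: split `η` into its blocks between summands and solve each
block separately. -/
theorem ExtVanishes.directSum {ι : Type} [Finite ι] (M : ι → QRep Q)
    (h : ∀ i j, ExtVanishes (M i) (M j)) :
    ExtVanishes (QRep.directSum M) (QRep.directSum M) := by
  classical
  cases nonempty_fintype ι
  intro η
  change ∀ a, (∀ i, (M i).space (Q.tail a)) →ₗ[ℂ] (∀ i, (M i).space (Q.head a)) at η
  choose f hf using fun i j => h i j fun a =>
    LinearMap.proj j ∘ₗ η a ∘ₗ LinearMap.single ℂ (fun i => (M i).space (Q.tail a)) i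
  let F : ∀ x, (∀ i, (M i).space x) →ₗ[ℂ] (∀ i, (M i).space x) := fun x =>
    LinearMap.pi fun j => ∑ i, f i j x ∘ₗ LinearMap.proj i
  have hF : ∀ x w j, F x w j = ∑ i, f i j x (w i) := fun x w j => by simp [F]
  refine ⟨F, fun a v => ?_⟩
  change ∀ i, (M i).space (Q.tail a) at v
  have hv : η a v = ∑ i, η a (Pi.single i (v i)) := by
    rw [← map_sum, Finset.univ_sum_single]
  refine funext fun j => ?_
  have key : ∀ i, f i j (Q.head a) ((M i).map a (v i)) -
      (M j).map a (f i j (Q.tail a) (v i)) = η a (Pi.single i (v i)) j :=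
    fun i => hf i j a (v i)
  have := Finset.sum_congr rfl fun i (_ : i ∈ Finset.univ) => key i
  rw [Finset.sum_sub_distrib, ← map_sum, ← Finset.sum_apply, ← hv] at this
  exact (congrArg₂ (· - ·) (hF _ _ _) (congrArg ((M j).map a) (hF _ _ _))).trans this

/-- The projection onto one summand is an endomorphism, hence a scalar `c`; it kills the first
summand if `c = 0` and the second one otherwise. -/
theorem IsBrick.indecomposable {V : QRep Q} (h : V.IsBrick) : V.Indecomposable := by
  refine ⟨h.1, fun M N ⟨e⟩ => ?_⟩
  let e' : ∀ x, V.space x ≃ₗ[ℂ] (M.space x × N.space x) := e.app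
  have he' : ∀ a v, e' _ (V.map a v) = (M.map a (e' _ v).1, N.map a (e' _ v).2) := e.comm
  obtain ⟨c, hc⟩ := h.2
    { app := fun x => (e' x).symm.toLinearMap ∘ₗ
        (LinearMap.inl ℂ (M.space x) (N.space x) ∘ₗ LinearMap.fst ℂ _ _) ∘ₗ
          (e' x).toLinearMap
      comm := fun a => by
        ext v
        apply (e' _).injective
        simp [he'] }
  have key : ∀ x (m : M.space x) (n : N.space x), (m, (0 : N.space x)) = c • (m, n) := by
    intro x m n
    apply (e' x).symm.injective
    have := hc x ((e' x).symm (m, n))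
    rw [← map_smul] at this
    simpa using this
  by_cases hc0 : c = 0
  · refine Or.inl fun x => subsingleton_of_forall_eq 0 fun m => ?_
    simpa [hc0] using congrArg Prod.fst (key x m 0)
  · refine Or.inr fun x => subsingleton_of_forall_eq 0 fun n => ?_
    have := congrArg Prod.snd (key x 0 n)
    exact (smul_eq_zero.mp this.symm).resolve_left hc0

/-- The dual representation of the opposite quiver. -/
def dual (V : QRep Q) : QRep Q.op where
  space x := Module.Dual ℂ (V.space x)
  map a := (V.map a).dualMap

theorem dualMap_surjective_of_finite {E F : Type} [AddCommGroup E] [Module ℂ E]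
    [FiniteDimensional ℂ E] [AddCommGroup F] [Module ℂ F] [FiniteDimensional ℂ F]
    (f : Module.Dual ℂ F →ₗ[ℂ] Module.Dual ℂ E) : ∃ g : E →ₗ[ℂ] F, g.dualMap = f := by
  refine ⟨(Module.evalEquiv ℂ F).symm.toLinearMap ∘ₗ f.dualMap ∘ₗ
    (Module.evalEquiv ℂ E).toLinearMap, ?_⟩
  ext φ v
  simp

theorem ExtVanishes.dual {V W : QRep Q} (h : ExtVanishes W V) : ExtVanishes V.dual W.dual := by
  intro η
  have h1 : ∀ a, ∃ g : W.space (Q.tail a) →ₗ[ℂ] V.space (Q.head a), g.dualMap = η a :=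
    fun a => dualMap_surjective_of_finite (η a)
  choose η' hη' using h1
  -- Transposing exchanges the two terms of the coboundary, hence the sign.
  obtain ⟨f, hf⟩ := h fun a => - η' a
  refine ⟨fun x => (f x).dualMap, fun a φ => ?_⟩
  change Module.Dual ℂ (V.space (Q.head a)) at φ
  rw [← hη' a]
  refine LinearMap.ext fun v => ?_
  change W.space (Q.tail a) at v
  have := congrArg φ (hf a v)
  rw [map_sub, LinearMap.neg_apply, map_neg, ← neg_inj, neg_sub, neg_neg] at this
  exact this

theorem IsBrick.dual {V : QRep Q} (h : V.IsBrick) : V.dual.IsBrick := by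
  refine ⟨fun h0 => h.1 fun x => ?_, fun f => ?_⟩
  · have := h0 x
    change Subsingleton (Module.Dual ℂ (V.space x)) at this
    exact (Module.subsingleton_dual_iff ℂ).mp this
  · choose g hg using fun x => dualMap_surjective_of_finite (f.app x)
    obtain ⟨c, hc⟩ := h.2
      { app := g
        comm := fun a => by
          refine LinearMap.ext fun v => ?_
          refine (Module.forall_dual_apply_eq_zero_iff ℂ _).mp ?_ |> sub_eq_zero.mp
          intro φ
          have := congrArg (fun ψ : Module.Dual ℂ (V.space (Q.tail a)) => ψ v)
            (LinearMap.congr_fun (f.comm a) φ)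
          rw [map_sub, sub_eq_zero]
          rw [← hg, ← hg] at this
          exact this.symm }
    refine ⟨c, fun x φ => ?_⟩
    change Module.Dual ℂ (V.space x) at φ
    rw [← hg x]
    refine LinearMap.ext fun v => ?_
    change φ (g x v) = c • φ v
    rw [show g x v = c • v from hc x v, map_smul]

theorem dimVector_dual (V : QRep Q) : V.dual.dimVector = V.dimVector :=
  funext fun _ => Subspace.dual_finrank_eq

end QRep

/-! ### Rigid representations are generic -/

namespace MvPolynomial

/-- Functions given by polynomials. -/
def IsPolynomialFun {I : Type} (F : (I → ℂ) → ℂ) : Prop :=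
  ∃ p : MvPolynomial I ℂ, ∀ w, eval w p = F w

namespace IsPolynomialFun

variable {I : Type} {F G : (I → ℂ) → ℂ}

theorem const (c : ℂ) : IsPolynomialFun fun _ : I → ℂ => c := ⟨C c, fun _ => eval_C _⟩

theorem coord (i : I) : IsPolynomialFun fun w : I → ℂ => w i := ⟨X i, fun _ => eval_X _⟩

theorem mul (hF : IsPolynomialFun F) (hG : IsPolynomialFun G) :
    IsPolynomialFun fun w => F w * G w := by
  obtain ⟨p, hp⟩ := hF
  obtain ⟨q, hq⟩ := hG
  exact ⟨p * q, fun w => by rw [map_mul, hp, hq]⟩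

theorem sub (hF : IsPolynomialFun F) (hG : IsPolynomialFun G) :
    IsPolynomialFun fun w => F w - G w := by
  obtain ⟨p, hp⟩ := hF
  obtain ⟨q, hq⟩ := hG
  exact ⟨p - q, fun w => by rw [map_sub, hp, hq]⟩

theorem sum {ι : Type} (s : Finset ι) {F : ι → (I → ℂ) → ℂ} (hF : ∀ i, IsPolynomialFun (F i)) :
    IsPolynomialFun fun w => ∑ i ∈ s, F i w := by
  choose p hp using hF
  exact ⟨∑ i ∈ s, p i, fun w => by simp only [map_sum, hp]⟩

theorem prod {ι : Type} (s : Finset ι) {F : ι → (I → ℂ) → ℂ} (hF : ∀ i, IsPolynomialFun (F i)) :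
    IsPolynomialFun fun w => ∏ i ∈ s, F i w := by
  choose p hp using hF
  exact ⟨∏ i ∈ s, p i, fun w => by simp only [map_prod, hp]⟩

variable {n : Type} [Fintype n] [DecidableEq n] {A : (I → ℂ) → Matrix n n ℂ}

theorem det (hA : ∀ i j, IsPolynomialFun fun w => A w i j) :
    IsPolynomialFun fun w => (A w).det := by
  choose p hp using hA
  refine ⟨(Matrix.of p).det, fun w => ?_⟩
  rw [RingHom.map_det]
  congr 1
  ext i j
  exact hp i j w

theorem adjugate (hA : ∀ i j, IsPolynomialFun fun w => A w i j) (i j : n) :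
    IsPolynomialFun fun w => (A w).adjugate i j := by
  choose p hp using hA
  refine ⟨(Matrix.of p).adjugate i j, fun w => ?_⟩
  have := congrFun (congrFun (RingHom.map_adjugate (eval w) (Matrix.of p)) i) j
  rw [RingHom.mapMatrix_apply, Matrix.map_apply] at this
  rw [this]
  congr 2
  ext i j
  exact hp i j w

end IsPolynomialFun

end MvPolynomial

namespace RepSpace

open MvPolynomial

variable {X A : Type} {Q : QuiverData X A} {α : X → ℕ}

/-- The entries of a point of `Rep(Q, α)`. -/
def entries (W : RepSpace Q α) : (Σ a : A, Fin (α (Q.head a)) × Fin (α (Q.tail a))) → ℂ :=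
  fun e => W e.1 e.2.1 e.2.2

/-- The point of `Rep(Q, α)` with given entries. -/
def ofEntries (w : (Σ a : A, Fin (α (Q.head a)) × Fin (α (Q.tail a))) → ℂ) : RepSpace Q α :=
  fun a => Matrix.of fun i j => w ⟨a, i, j⟩

/-- The failure of a family of matrices to be a morphism from `V` to the point with entries `w`. -/
noncomputable def defect (V : RepSpace Q α)
    (w : (Σ a : A, Fin (α (Q.head a)) × Fin (α (Q.tail a))) → ℂ) :
    (∀ x, Matrix (Fin (α x)) (Fin (α x)) ℂ) →ₗ[ℂ]
      ((Σ a : A, Fin (α (Q.head a)) × Fin (α (Q.tail a))) → ℂ) where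
  toFun g e := ∑ k, g (Q.head e.1) e.2.1 k * V e.1 k e.2.2 -
    ∑ k, w ⟨e.1, e.2.1, k⟩ * g (Q.tail e.1) k e.2.2
  map_add' g h := by
    ext e
    simp only [Pi.add_apply, Matrix.add_apply, add_mul, mul_add, Finset.sum_add_distrib]
    ring
  map_smul' c g := by
    ext e
    simp only [Pi.smul_apply, Matrix.smul_apply, smul_eq_mul, RingHom.id_apply, mul_sub,
      Finset.mul_sum]
    congr 1 <;> exact Finset.sum_congr rfl fun _ _ => by ring

theorem defect_apply (V W : RepSpace Q α) (g : ∀ x, Matrix (Fin (α x)) (Fin (α x)) ℂ)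
    (e : Σ a : A, Fin (α (Q.head a)) × Fin (α (Q.tail a))) :
    defect V (entries W) g e = (g (Q.head e.1) * V e.1 - W e.1 * g (Q.tail e.1)) e.2.1 e.2.2 := rfl

theorem isPolynomialFun_defect (V : RepSpace Q α) (g : ∀ x, Matrix (Fin (α x)) (Fin (α x)) ℂ)
    (e : Σ a : A, Fin (α (Q.head a)) × Fin (α (Q.tail a))) :
    IsPolynomialFun fun w => defect V w g e :=
  .sub (.const _) (.sum _ fun _ => .mul (.coord _) (.const _))

theorem exists_act_eq {V W : RepSpace Q α} (g : ∀ x, Matrix (Fin (α x)) (Fin (α x)) ℂ)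
    (hg : ∀ x, (g x).det ≠ 0) (h : ∀ a, g (Q.head a) * V a = W a * g (Q.tail a)) :
    ∃ u : ∀ x, GL (Fin (α x)) ℂ, act u V = W := by
  refine ⟨fun x => Matrix.GeneralLinearGroup.mkOfDetNeZero (g x) (hg x), funext fun a => ?_⟩
  have h1 : g (Q.tail a) *
      ((Matrix.GeneralLinearGroup.mkOfDetNeZero (g (Q.tail a)) (hg _))⁻¹).val = 1 :=
    (Matrix.GeneralLinearGroup.mkOfDetNeZero (g (Q.tail a)) (hg _)).mul_inv
  change g (Q.head a) * V a * _ = _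
  rw [h, Matrix.mul_assoc, h1, Matrix.mul_one]

/-- The orbit of a rigid representation contains the complement of a hypersurface which does not
pass through it. -/
theorem exists_polynomial_of_rigid [Fintype X] [Finite A] (V : RepSpace Q α)
    (hV : Function.Surjective (defect V (entries V))) :
    ∃ f : MvPolynomial (Σ a : A, Fin (α (Q.head a)) × Fin (α (Q.tail a))) ℂ,
      evalPoly f V ≠ 0 ∧
        ∀ W : RepSpace Q α, evalPoly f W ≠ 0 → ∃ u : ∀ x, GL (Fin (α x)) ℂ, act u V = W := by
  classical
  cases nonempty_fintype A
  -- The idea is to correct the identity to a morphism from `V` to `W` by Cramer's rule. The map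
  -- `defect V w ∘ σ` is the identity at `w = V`, and multiplying by its determinant avoids
  -- denominators, so that `g` is polynomial in `w`.
  obtain ⟨σ, hσ⟩ := LinearMap.exists_rightInverse_of_surjective _ (LinearMap.range_eq_top.mpr hV)
  let L := fun w => LinearMap.toMatrix' (defect V w ∘ₗ σ)
  let t := fun w => (L w).adjugate.mulVec (defect V w 1)
  let g := fun w => (L w).det • 1 - σ (t w)
  have hL : ∀ i j, IsPolynomialFun fun w => L w i j := fun i j => by
    simp only [L, LinearMap.toMatrix'_apply, LinearMap.comp_apply]
    exact isPolynomialFun_defect _ _ _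
  have ht : ∀ i, IsPolynomialFun fun w => t w i := fun i =>
    .sum _ fun j => .mul (.adjugate hL i j) (isPolynomialFun_defect _ _ _)
  have hσt : ∀ w x i j, σ (t w) x i j = ∑ e, t w e * σ (Pi.single e 1) x i j := by
    intro w x i j
    conv_lhs => rw [pi_eq_sum_univ' (t w), map_sum]
    simp [Finset.sum_apply, Matrix.sum_apply]
  have hg : ∀ x i j, IsPolynomialFun fun w => g w x i j := fun x i j => by
    simp only [g, Pi.sub_apply, Matrix.sub_apply, Pi.smul_apply, Matrix.smul_apply, hσt]
    exact .sub (.mul (.det hL) (.const _)) (.sum _ fun e => .mul (ht e) (.const _))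
  obtain ⟨f, hf⟩ := IsPolynomialFun.prod Finset.univ fun x => IsPolynomialFun.det (hg x)
  refine ⟨f, ?_, fun W hW => ?_⟩
  · change eval (entries V) f ≠ 0
    -- At `V` itself the identity needs no correction, so `g = 1` and `f` takes the value one.
    have h1 : defect V (entries V) 1 = 0 := by
      ext e
      simp [defect_apply]
    have h2 : g (entries V) = 1 := by
      simp [g, t, L, h1, hσ]
    rw [hf]
    simp [h2]
  · rw [show evalPoly f W = _ from hf (entries W), Finset.prod_ne_zero_iff] at hW
    refine exists_act_eq (g (entries W)) (fun x => hW x (Finset.mem_univ x)) fun a => ?_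
    -- This is `L * adjugate L = det L • 1` applied to the defect of the identity.
    have key : defect V (entries W) (g (entries W)) = 0 := by
      have h3 : defect V (entries W) (σ (t (entries W))) =
          (L (entries W)).mulVec (t (entries W)) := by
        simp only [L, LinearMap.toMatrix'_mulVec, LinearMap.comp_apply]
      simp only [g, map_sub, map_smul, h3]
      simp only [t, Matrix.mulVec_mulVec, Matrix.mul_adjugate, Matrix.smul_mulVec,
        Matrix.one_mulVec, sub_self]
    ext i j
    exact sub_eq_zero.mp (congrFun key ⟨a, i, j⟩)

/-- A polynomial `p` vanishing on the orbit gives `p * f = 0` everywhere, and polynomials over `ℂ`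
form a domain. -/
theorem isGeneric_of_rigid [Fintype X] [Finite A] {V : RepSpace Q α}
    (hV : Function.Surjective (defect V (entries V))) : V.IsGeneric := by
  intro p hp
  obtain ⟨f, hfV, hf⟩ := exists_polynomial_of_rigid V hV
  have h0 : p * f = 0 := by
    refine MvPolynomial.funext fun w => ?_
    rw [map_mul, map_zero, mul_eq_zero]
    by_contra! hne
    obtain ⟨u, hu⟩ := hf (ofEntries w) hne.2
    exact hne.1 (by have := hp u; rwa [hu] at this)
  refine (mul_eq_zero.mp h0).resolve_right ?_
  rintro rfl
  exact hfV (map_zero _)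

/-- A base change is an isomorphism of representations. -/
theorem nonempty_iso_act (V : RepSpace Q α) (u : ∀ x, GL (Fin (α x)) ℂ) :
    Nonempty (QRep.Iso V.toQRep (act u V).toQRep) :=
  ⟨{ app := fun x => Matrix.toLin'OfInv (M := ((u x)⁻¹).val) (M' := (u x).val)
        (u x).inv_mul (u x).mul_inv
     comm := fun a v => by
      change Fin (α (Q.tail a)) → ℂ at v
      change (u (Q.head a)).val.mulVec ((V a).mulVec v) =
        ((u (Q.head a)).val * V a * ((u (Q.tail a))⁻¹).val).mulVec ((u (Q.tail a)).val.mulVec v)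
      have h1 : ((u (Q.tail a))⁻¹).val * (u (Q.tail a)).val = 1 := (u _).inv_mul
      rw [Matrix.mulVec_mulVec, Matrix.mulVec_mulVec, Matrix.mul_assoc _ ((u _)⁻¹).val, h1,
        Matrix.mul_one] }⟩

theorem surjective_defect {V : RepSpace Q α} (hV : QRep.ExtVanishes V.toQRep V.toQRep) :
    Function.Surjective (defect V (entries V)) := by
  intro w
  obtain ⟨f, hf⟩ := hV fun a => (ofEntries w a).mulVecLin
  change ∀ x, (Fin (α x) → ℂ) →ₗ[ℂ] (Fin (α x) → ℂ) at f
  refine ⟨fun x => LinearMap.toMatrix' (f x), funext fun e => ?_⟩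
  obtain ⟨a, i, j⟩ := e
  rw [defect_apply]
  have : LinearMap.toMatrix' (f (Q.head a)) * V a - V a * LinearMap.toMatrix' (f (Q.tail a)) =
      ofEntries w a := by
    refine Matrix.mulVec_injective (funext fun v => ?_)
    rw [Matrix.sub_mulVec, ← Matrix.mulVec_mulVec, ← Matrix.mulVec_mulVec,
      LinearMap.toMatrix'_mulVec, LinearMap.toMatrix'_mulVec]
    exact hf a v
  exact congrFun (congrFun this i) j

/-- Every representation is given by a point of `Rep(Q, α)`. -/
theorem exists_iso_toQRep (M : QRep Q) (hM : M.dimVector = α) :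
    ∃ V : RepSpace Q α, Nonempty (QRep.Iso V.toQRep M) := by
  subst hM
  let b : ∀ x, Module.Basis (Fin (M.dimVector x)) ℂ (M.space x) := fun x =>
    Module.finBasis ℂ (M.space x)
  refine ⟨fun a => LinearMap.toMatrix (b _) (b _) (M.map a),
    ⟨{ app := fun x => (b x).equivFun.symm, comm := fun a v => ?_ }⟩⟩
  change Fin (M.dimVector (Q.tail a)) → ℂ at v
  refine (LinearEquiv.symm_apply_eq _).mpr ?_
  change (LinearMap.toMatrix (b _) (b _) (M.map a)).mulVec v = _
  have := LinearMap.toMatrix_mulVec_repr (b _) (b _) (M.map a) ((b (Q.tail a)).equivFun.symm v)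
  have h2 : ⇑((b (Q.tail a)).repr ((b (Q.tail a)).equivFun.symm v)) = v :=
    (b (Q.tail a)).equivFun.apply_symm_apply v
  rw [h2] at this
  exact this

end RepSpace

/-! ### From rigid lists to generic decompositions -/

/-- `l` is the list of dimension vectors of a list of bricks without extensions between them. -/
def IsRigidList {X A : Type} (Q : QuiverData X A) (l : List (X → ℕ)) : Prop :=
  ∃ L : List (QRep Q), L.map QRep.dimVector = l ∧ (∀ M ∈ L, M.IsBrick) ∧
    ∀ M ∈ L, ∀ N ∈ L, M.ExtVanishes N

theorem IsRigidList.op {X A : Type} {Q : QuiverData X A} {l : List (X → ℕ)}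
    (h : IsRigidList Q l) : IsRigidList Q.op l := by
  obtain ⟨L, hl, hb, hE⟩ := h
  refine ⟨L.map QRep.dual, ?_, ?_, ?_⟩
  · rw [List.map_map, ← hl]
    exact List.map_congr_left fun M _ => M.dimVector_dual
  · simp only [List.mem_map, forall_exists_index, and_imp, forall_apply_eq_imp_iff₂]
    exact fun M hM => (hb M hM).dual
  · simp only [List.mem_map, forall_exists_index, and_imp, forall_apply_eq_imp_iff₂]
    exact fun M hM N hN => (hE N hN M hM).dual

theorem IsRigidList.isGenericDecomposition {X A : Type} [Fintype X] [Finite A]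
    {Q : QuiverData X A} {l : List (X → ℕ)} {α : X → ℕ} (h : IsRigidList Q l) (hα : l.sum = α) :
    IsGenericDecomposition Q α l := by
  obtain ⟨L, rfl, hb, hE⟩ := h
  let M : Fin (L.map QRep.dimVector).length → QRep Q := fun i =>
    L.get (i.cast (List.length_map _))
  have hdim : ∀ i, (M i).dimVector = (L.map QRep.dimVector).get i := fun i => by simp [M]
  have hM : (QRep.directSum M).DecomposesAs (L.map QRep.dimVector) :=
    ⟨M, fun i => ⟨(hb _ (List.get_mem _ _)).indecomposable, hdim i⟩,
      ⟨{ app := fun x => LinearEquiv.refl ℂ _, comm := fun _ _ => rfl }⟩⟩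
  have hsum : (QRep.directSum M).dimVector = α := by
    ext x
    change Module.finrank ℂ (∀ i, (M i).space x) = _
    rw [Module.finrank_pi_fintype, ← hα, ← Fin.sum_univ_getElem, Finset.sum_apply]
    exact Finset.sum_congr rfl fun i _ => congrFun (hdim i) x
  obtain ⟨V, ⟨e⟩⟩ := RepSpace.exists_iso_toQRep _ hsum
  have hV : Function.Surjective (RepSpace.defect V V.entries) :=
    RepSpace.surjective_defect ((QRep.ExtVanishes.directSum M fun i j =>
      hE _ (List.get_mem _ _) _ (List.get_mem _ _)).of_iso e)
  refine ⟨⟨V, RepSpace.isGeneric_of_rigid hV⟩, fun W hW => ?_⟩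
  obtain ⟨f, hfV, hf⟩ := RepSpace.exists_polynomial_of_rigid V hV
  -- The dense orbit of `W` cannot lie in the zero set of `f`, so it meets the orbit of `V`.
  obtain ⟨g, hg⟩ : ∃ g, RepSpace.evalPoly f (RepSpace.act g W) ≠ 0 := by
    by_contra! h0
    obtain rfl := hW f h0
    exact hfV (map_zero _)
  obtain ⟨u, hu⟩ := hf _ hg
  obtain ⟨e₁⟩ := RepSpace.nonempty_iso_act W g
  obtain ⟨e₂⟩ := RepSpace.nonempty_iso_act V u
  rw [hu] at e₂
  exact hM.of_iso (e₁.trans (e₂.symm.trans e))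

/-! ### Representations with a basis -/

section Coordinates

variable {X A : Type} {Q : QuiverData X A} {ι κ : Type}

/-- The representation with basis `P x` at the vertex `x` and matrix entries `C a i j`. -/
noncomputable def coordRep (Q : QuiverData X A) (P : X → Finset ι) (C : A → ι → ι → ℂ) :
    QRep Q where
  space x := P x → ℂ
  map a := (Matrix.of fun (i : P (Q.head a)) (j : P (Q.tail a)) => C a i j).mulVecLin

theorem dimVector_coordRep (P : X → Finset ι) (C : A → ι → ι → ℂ) :
    (coordRep Q P C).dimVector = fun x => (P x).card := by
  ext x
  change Module.finrank ℂ (P x → ℂ) = _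
  simp

/-- The failure of a family of matrices to be a morphism. -/
noncomputable def coordDefect (P : X → Finset ι) (C : A → ι → ι → ℂ) (P' : X → Finset κ)
    (C' : A → κ → κ → ℂ) (Q : QuiverData X A) (F : X → κ → ι → ℂ) (a : A) (t : κ) (s : ι) : ℂ :=
  ∑ u ∈ P (Q.head a), F (Q.head a) t u * C a u s - ∑ u ∈ P' (Q.tail a), C' a t u * F (Q.tail a) u s

variable {P : X → Finset ι} {C : A → ι → ι → ℂ} {P' : X → Finset κ} {C' : A → κ → κ → ℂ}

/-- Matrices indexed by all labels avoid index types depending on the vertex; entries outside the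
bases play no role. -/
theorem extVanishes_coordRep
    (h : ∀ η : A → κ → ι → ℂ, ∃ F : X → κ → ι → ℂ, ∀ a, ∀ s ∈ P (Q.tail a), ∀ t ∈ P' (Q.head a),
      coordDefect P C P' C' Q F a t s = η a t s) :
    QRep.ExtVanishes (coordRep Q P C) (coordRep Q P' C') := by
  classical
  intro η
  change ∀ a, (P (Q.tail a) → ℂ) →ₗ[ℂ] (P' (Q.head a) → ℂ) at η
  obtain ⟨F, hF⟩ := h fun a t s => if hs : s ∈ P (Q.tail a) then
    if ht : t ∈ P' (Q.head a) then LinearMap.toMatrix' (η a) ⟨t, ht⟩ ⟨s, hs⟩ else 0 else 0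
  let G : ∀ x, Matrix (P' x) (P x) ℂ := fun x => Matrix.of fun t s => F x t s
  refine ⟨fun x => (G x).mulVecLin, fun a v => ?_⟩
  change P (Q.tail a) → ℂ at v
  have key : G (Q.head a) * (Matrix.of fun (i : P (Q.head a)) (j : P (Q.tail a)) => C a i j) -
      (Matrix.of fun (i : P' (Q.head a)) (j : P' (Q.tail a)) => C' a i j) * G (Q.tail a) =
      LinearMap.toMatrix' (η a) := by
    ext t s
    have := hF a s s.2 t t.2
    rw [dif_pos s.2, dif_pos t.2, coordDefect, ← Finset.sum_coe_sort (P _),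
      ← Finset.sum_coe_sort (P' _)] at this
    exact this
  have h2 := congrArg (fun M => M.mulVec v) key
  simp only [Matrix.sub_mulVec, ← Matrix.mulVec_mulVec, LinearMap.toMatrix'_mulVec] at h2
  exact h2

theorem exists_matrix_of_hom (f : QRep.Hom (coordRep Q P C) (coordRep Q P' C')) :
    ∃ F : X → κ → ι → ℂ,
      (∀ a, ∀ s ∈ P (Q.tail a), ∀ t ∈ P' (Q.head a), coordDefect P C P' C' Q F a t s = 0) ∧
      ∀ x (v : P x → ℂ) (t : P' x), f.app x v t = ∑ s : P x, F x t s * v s := by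
  classical
  let g : ∀ x, (P x → ℂ) →ₗ[ℂ] (P' x → ℂ) := f.app
  let F : X → κ → ι → ℂ := fun x t s => if hs : s ∈ P x then
    if ht : t ∈ P' x then LinearMap.toMatrix' (g x) ⟨t, ht⟩ ⟨s, hs⟩ else 0 else 0
  have hF : ∀ x (t : P' x) (s : P x), F x t s = LinearMap.toMatrix' (g x) t s := fun x t s => by
    simp only [F, dif_pos s.2, dif_pos t.2]
  refine ⟨F, fun a s hs t ht => ?_, fun x v t => ?_⟩
  · have key : LinearMap.toMatrix' (g (Q.head a)) *
        (Matrix.of fun (i : P (Q.head a)) (j : P (Q.tail a)) => C a i j) =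
        (Matrix.of fun (i : P' (Q.head a)) (j : P' (Q.tail a)) => C' a i j) *
          LinearMap.toMatrix' (g (Q.tail a)) := by
      refine Matrix.mulVec_injective (funext fun v => ?_)
      rw [← Matrix.mulVec_mulVec, ← Matrix.mulVec_mulVec, LinearMap.toMatrix'_mulVec,
        LinearMap.toMatrix'_mulVec]
      exact LinearMap.congr_fun (f.comm a) v
    have := congrFun (congrFun key ⟨t, ht⟩) ⟨s, hs⟩
    rw [Matrix.mul_apply, Matrix.mul_apply, ← sub_eq_zero] at this
    rw [coordDefect, ← Finset.sum_coe_sort (P _), ← Finset.sum_coe_sort (P' _), ← this]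
    congr 1
    · exact Finset.sum_congr rfl fun u _ => by rw [hF _ ⟨t, ht⟩ u]; rfl
    · exact Finset.sum_congr rfl fun u _ => by rw [hF _ u ⟨s, hs⟩]; rfl
  · simp only [hF]
    exact congrFun (LinearMap.toMatrix'_mulVec (g x) v).symm t

theorem isBrick_coordRep [DecidableEq ι] (hne : ∃ x, (P x).Nonempty)
    (h : ∀ F : X → ι → ι → ℂ,
      (∀ a, ∀ s ∈ P (Q.tail a), ∀ t ∈ P (Q.head a), coordDefect P C P C Q F a t s = 0) →
      ∃ c : ℂ, ∀ x, ∀ s ∈ P x, ∀ t ∈ P x, F x t s = if s = t then c else 0) :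
    (coordRep Q P C).IsBrick := by
  refine ⟨fun h0 => ?_, fun f => ?_⟩
  · obtain ⟨x, i, hi⟩ := hne
    have : Subsingleton (P x → ℂ) := h0 x
    exact zero_ne_one (congrFun (Subsingleton.elim (0 : P x → ℂ) 1) ⟨i, hi⟩)
  · obtain ⟨F, hF, hf⟩ := exists_matrix_of_hom f
    obtain ⟨c, hc⟩ := h F hF
    refine ⟨c, fun x v => ?_⟩
    change P x → ℂ at v
    refine funext fun t => ?_
    rw [hf]
    change _ = c * v t
    rw [Finset.sum_eq_single t]
    · rw [hc x t t.2 t t.2, if_pos rfl]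
    · intro s _ hs
      rw [hc x s s.2 t t.2, if_neg fun hst => hs (Subtype.ext hst), zero_mul]
    · simp

end Coordinates

/-! ### Thin representations -/

section Thin

variable {X A : Type} (Q : QuiverData X A)

/-- The failure of a family of scalars to be a morphism between thin representations with the
supports of `β` and `γ`. -/
noncomputable def thinDefect (β γ : X → ℕ) (f : X → ℂ) (a : A) : ℂ :=
  (if β (Q.head a) ≠ 0 then f (Q.head a) else 0) - (if γ (Q.tail a) ≠ 0 then f (Q.tail a) else 0)

/-- `f` is a morphism between thin representations. -/
def IsThinHom (β γ : X → ℕ) (f : X → ℂ) : Prop :=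
  ∀ a, β (Q.tail a) ≠ 0 → γ (Q.head a) ≠ 0 → thinDefect Q β γ f a = 0

/-- There are no extensions between thin representations. -/
def ThinExtVanishes (β γ : X → ℕ) : Prop :=
  ∀ η : A → ℂ, ∃ f : X → ℂ, ∀ a, β (Q.tail a) ≠ 0 → γ (Q.head a) ≠ 0 → thinDefect Q β γ f a = η a

/-- The endomorphisms of the thin representation are scalars. -/
def IsThinBrick (β : X → ℕ) : Prop :=
  ∀ f, IsThinHom Q β β f → ∀ x y, β x ≠ 0 → β y ≠ 0 → f x = f y

/-- There is a morphism between thin representations which is not zero at `p`. -/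
def ThinHomAt (p : X) (β γ : X → ℕ) : Prop :=
  β p ≠ 0 ∧ γ p ≠ 0 ∧ ∃ f, IsThinHom Q β γ f ∧ f p = 1

variable {Q}

theorem ThinHomAt.trans {p : X} {β γ δ : X → ℕ} (h : ThinHomAt Q p β γ)
    (h' : ThinHomAt Q p γ δ) : ThinHomAt Q p β δ := by
  obtain ⟨hβ, hγ, f, hf, hfp⟩ := h
  obtain ⟨-, hδ, g, hg, hgp⟩ := h'
  -- The composite must be cut off outside the support of `γ`, where `f` and `g` carry arbitrary
  -- values.
  refine ⟨hβ, hδ, fun x => if γ x ≠ 0 then g x * f x else 0, fun a h1 h2 => ?_, ?_⟩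
  · have hf' := hf a h1
    have hg' := fun h => hg a h h2
    simp only [thinDefect] at hf' hg' ⊢
    by_cases h3 : γ (Q.head a) = 0 <;> by_cases h4 : γ (Q.tail a) = 0 <;>
      by_cases h5 : β (Q.head a) = 0 <;> by_cases h6 : δ (Q.tail a) = 0 <;>
      simp_all [sub_eq_zero]
  · simp [hγ, hfp, hgp]

theorem isThinHom_zero_of_not_hasNonzeroHom {β γ : X → ℕ} (hβ : ∀ x, β x ≤ 1)
    (hγ : ∀ x, γ x ≤ 1) (h : ¬ (thinRep Q β).toQRep.HasNonzeroHom (thinRep Q γ).toQRep)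
    {f : X → ℂ} (hf : IsThinHom Q β γ f) {x : X} (hβx : β x ≠ 0) (hγx : γ x ≠ 0) : f x = 0 := by
  by_contra hfx
  refine h ⟨{ app := fun x => (Matrix.of fun (_ : Fin (γ x)) (_ : Fin (β x)) => f x).mulVecLin,
              comm := fun a => ?_ }, x, fun h0 => hfx ?_⟩
  · change Matrix.mulVecLin _ ∘ₗ Matrix.mulVecLin _ = Matrix.mulVecLin _ ∘ₗ Matrix.mulVecLin _
    rw [← Matrix.mulVecLin_mul, ← Matrix.mulVecLin_mul]
    congr 1
    ext i j
    have hb : β (Q.tail a) = 1 := le_antisymm (hβ _) (Fin.pos j)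
    have hc : γ (Q.head a) = 1 := le_antisymm (hγ _) (Fin.pos i)
    have := hf a (by simp [hb]) (by simp [hc])
    rw [thinDefect, sub_eq_zero] at this
    simp only [Matrix.mul_apply, thinRep, Matrix.of_apply, mul_one, one_mul, Finset.sum_const,
      Finset.card_univ, Fintype.card_fin]
    have e1 : ∀ n : ℕ, n ≤ 1 → ∀ c : ℂ, n • c = if n ≠ 0 then c else 0 := by
      intro n hn c
      interval_cases n <;> simp
    rw [e1 _ (hβ _), e1 _ (hγ _), this]
  · have h1 := LinearMap.congr_fun h0 (fun _ => 1 : Fin (β x) → ℂ)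
    have h2 : (Matrix.of fun (_ : Fin (γ x)) (_ : Fin (β x)) => f x).mulVec (fun _ => 1) = 0 := h1
    have h3 := congrFun h2 ⟨0, Nat.pos_of_ne_zero hγx⟩
    simpa [Matrix.mulVec, dotProduct, hβx] using h3

theorem exists_isThinHom_of_hasNonzeroHom {β γ : X → ℕ} (hβ : ∀ x, β x ≤ 1)
    (hγ : ∀ x, γ x ≤ 1) (h : (thinRep Q β).toQRep.HasNonzeroHom (thinRep Q γ).toQRep) :
    ∃ f x, IsThinHom Q β γ f ∧ β x ≠ 0 ∧ γ x ≠ 0 ∧ f x ≠ 0 := by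
  obtain ⟨φ, x, hx⟩ := h
  let g : ∀ x, (Fin (β x) → ℂ) →ₗ[ℂ] (Fin (γ x) → ℂ) := φ.app
  -- With dimensions at most one, this sum is the only matrix entry of `g x`, or zero if there is
  -- none.
  let f : X → ℂ := fun x => ∑ i : Fin (γ x), g x (fun _ => 1) i
  have e1 : ∀ n : ℕ, n ≤ 1 → ∀ c : ℂ, n • c = if n ≠ 0 then c else 0 := by
    intro n hn c
    interval_cases n <;> simp
  have hg : ∀ x v i, g x v i = f x * ∑ j, v j := by
    intro x v i
    have hc : γ x = 1 := le_antisymm (hγ _) (Fin.pos i)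
    have hsub : Subsingleton (Fin (γ x)) := by rw [hc]; infer_instance
    have hv : v = (∑ j, v j) • fun _ => 1 := by
      ext j
      have hb : β x = 1 := le_antisymm (hβ _) (Fin.pos j)
      have hsub' : Subsingleton (Fin (β x)) := by rw [hb]; infer_instance
      simp [Fintype.sum_subsingleton _ j]
    conv_lhs => rw [hv]
    rw [map_smul]
    simp only [f, Fintype.sum_subsingleton _ i, Pi.smul_apply, smul_eq_mul]
    ring
  have hne : ∃ i v, g x v i ≠ 0 := by
    by_contra! h0
    exact hx (LinearMap.ext fun v => funext fun i => h0 i v)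
  obtain ⟨i, v, hiv⟩ := hne
  rw [hg] at hiv
  refine ⟨f, x, fun a hb hc => ?_, ?_, fun h0 => (h0 ▸ i).elim0, left_ne_zero_of_mul hiv⟩
  · have h1 := congrFun (LinearMap.congr_fun (φ.comm a) (fun _ => 1 : Fin (β (Q.tail a)) → ℂ))
      ⟨0, Nat.pos_of_ne_zero hc⟩
    change g (Q.head a) ((Matrix.of fun (_ : Fin (β (Q.head a))) (_ : Fin (β (Q.tail a))) =>
      (1 : ℂ)).mulVec fun _ => 1) _ = (Matrix.of fun (_ : Fin (γ (Q.head a)))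
        (_ : Fin (γ (Q.tail a))) => (1 : ℂ)).mulVec (g (Q.tail a) fun _ => 1) _ at h1
    have hb1 : β (Q.tail a) = 1 := le_antisymm (hβ _) (Nat.pos_of_ne_zero hb)
    rw [hg] at h1
    simp only [Matrix.mulVec, dotProduct, Matrix.of_apply, mul_one, one_mul, Finset.sum_const,
      Finset.card_univ, Fintype.card_fin, hg, hb1, one_smul, nsmul_eq_mul] at h1
    rw [thinDefect, sub_eq_zero, ← e1 _ (hβ _), ← e1 _ (hγ _), nsmul_eq_mul, nsmul_eq_mul, mul_comm,
      h1]
  · intro h0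
    refine right_ne_zero_of_mul hiv (Finset.sum_eq_zero fun j _ => ?_)
    exact (h0 ▸ j).elim0

/-- The thin representation with the support of `β`. -/
noncomputable def thinCoordRep (Q : QuiverData X A) (β : X → ℕ) : QRep Q :=
  coordRep Q (fun x => Finset.univ.filter fun _ : Unit => β x ≠ 0) fun _ _ _ => 1

theorem dimVector_thinCoordRep {β : X → ℕ} (hβ : ∀ x, β x ≤ 1) :
    (thinCoordRep Q β).dimVector = β := by
  rw [thinCoordRep, dimVector_coordRep]
  ext x
  have := hβ x
  interval_cases h : β x <;> simp

theorem coordDefect_unit (β γ : X → ℕ) (F : X → Unit → Unit → ℂ) (a : A) :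
    coordDefect (fun x => Finset.univ.filter fun _ : Unit => β x ≠ 0) (fun _ _ _ => 1)
      (fun x => Finset.univ.filter fun _ : Unit => γ x ≠ 0) (fun _ _ _ => 1) Q F a () () =
      thinDefect Q β γ (fun x => F x () ()) a := by
  simp only [coordDefect, thinDefect, Finset.sum_filter, Finset.univ_unique, Finset.sum_singleton,
    mul_one, one_mul]

theorem extVanishes_thinCoordRep {β γ : X → ℕ} (h : ThinExtVanishes Q β γ) :
    (thinCoordRep Q β).ExtVanishes (thinCoordRep Q γ) := by
  refine extVanishes_coordRep fun η => ?_
  obtain ⟨f, hf⟩ := h fun a => η a () ()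
  refine ⟨fun x _ _ => f x, fun a s hs t ht => ?_⟩
  rw [coordDefect_unit]
  exact hf a (Finset.mem_filter.mp hs).2 (Finset.mem_filter.mp ht).2

theorem isBrick_thinCoordRep {β : X → ℕ} (h0 : ∃ x, β x ≠ 0) (h : IsThinBrick Q β) :
    (thinCoordRep Q β).IsBrick := by
  obtain ⟨p, hp⟩ := h0
  refine isBrick_coordRep ⟨p, (), by simp [hp]⟩ fun F hF => ⟨F p () (), fun x s hs t ht => ?_⟩
  rw [if_pos rfl]
  refine h (fun x => F x () ()) (fun a h1 h2 => ?_) x p (Finset.mem_filter.mp hs).2 hp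
  rw [← coordDefect_unit]
  exact hF a () (by simp [h1]) () (by simp [h2])

end Thin

/-! ### Type A -/

section TypeA

variable {m : ℕ} {o : Fin m → Bool} {d : Fin (m + 1) → ℕ} {r r' : ℤ} {β γ : Fin (m + 1) → ℕ}

theorem topRow_succ (o : Fin m → Bool) (d : Fin (m + 1) → ℕ) (e : Fin m) :
    topRow o d e.succ = if o e then topRow o d e.castSucc + (d e.castSucc : ℤ) - (d e.succ : ℤ)
      else topRow o d e.castSucc := by
  simp only [topRow, Fin.induction_succ]

/-- The support of `β` is a union of connected components of row `r` of the diagram. -/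
def IsRowSupport (o : Fin m → Bool) (d : Fin (m + 1) → ℕ) (r : ℤ) (β : Fin (m + 1) → ℕ) : Prop :=
  (∀ i, β i ≠ 0 → IsDot o d r i) ∧
    ∀ e : Fin m, IsDot o d r e.castSucc → IsDot o d r e.succ →
      (β e.castSucc ≠ 0 ↔ β e.succ ≠ 0)

/-- The support of `β` is an interval. -/
def IsIntervalSupport (β : Fin (m + 1) → ℕ) : Prop :=
  ∀ i j l, i ≤ l → l ≤ j → β i ≠ 0 → β j ≠ 0 → β l ≠ 0

theorem isDot_succ_iff_of_right {e : Fin m} (he : o e = true) :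
    IsDot o d r e.succ ↔ topRow o d e.castSucc + (d e.castSucc : ℤ) - (d e.succ : ℤ) ≤ r ∧
      r < topRow o d e.castSucc + (d e.castSucc : ℤ) := by
  rw [IsDot, topRow_succ, if_pos he, sub_add_cancel]

theorem isDot_succ_iff_of_left {e : Fin m} (he : o e = false) :
    IsDot o d r e.succ ↔ topRow o d e.castSucc ≤ r ∧
      r < topRow o d e.castSucc + (d e.succ : ℤ) := by
  rw [IsDot, topRow_succ, if_neg (by simp [he])]

/-- Both columns end at the same bottom row, so a column having a dot in the higher row continues
down through the lower one. The next three lemmas are the analogues for the other column and for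
alignment at the top. -/
theorem isDot_succ_of_right {e : Fin m} (he : o e = true) (h : r' ≤ r)
    (h1 : IsDot o d r e.castSucc) (h2 : IsDot o d r' e.succ) : IsDot o d r e.succ := by
  rw [isDot_succ_iff_of_right he] at *
  exact ⟨h2.1.trans h, h1.2⟩

theorem isDot_castSucc_of_right {e : Fin m} (he : o e = true) (h : r ≤ r')
    (h1 : IsDot o d r e.castSucc) (h2 : IsDot o d r' e.succ) : IsDot o d r' e.castSucc := by
  rw [isDot_succ_iff_of_right he] at *
  exact ⟨h1.1.trans h, h2.2⟩

theorem isDot_succ_of_left {e : Fin m} (he : o e = false) (h : r' ≤ r)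
    (h1 : IsDot o d r e.succ) (h2 : IsDot o d r' e.castSucc) : IsDot o d r' e.succ := by
  rw [isDot_succ_iff_of_left he] at *
  exact ⟨h2.1, h.trans_lt h1.2⟩

theorem isDot_castSucc_of_left {e : Fin m} (he : o e = false) (h : r ≤ r')
    (h1 : IsDot o d r e.succ) (h2 : IsDot o d r' e.castSucc) : IsDot o d r e.castSucc := by
  rw [isDot_succ_iff_of_left he] at *
  exact ⟨h1.1, h.trans_lt h2.2⟩

theorem thinDefect_typeA_right {e : Fin m} (he : o e = true) (f : Fin (m + 1) → ℂ) :
    thinDefect (typeA o) β γ f e = (if β e.succ ≠ 0 then f e.succ else 0) -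
      (if γ e.castSucc ≠ 0 then f e.castSucc else 0) := by
  simp [thinDefect, typeA, he]

theorem thinDefect_typeA_left {e : Fin m} (he : o e = false) (f : Fin (m + 1) → ℂ) :
    thinDefect (typeA o) β γ f e = (if β e.castSucc ≠ 0 then f e.castSucc else 0) -
      (if γ e.succ ≠ 0 then f e.succ else 0) := by
  simp [thinDefect, typeA, he]

/-- To check a statement on all arrows from the support of `β` to the support of `γ`. -/
theorem forall_arrow_typeA {p : Fin m → Prop}
    (hr : ∀ e, o e = true → β e.castSucc ≠ 0 → γ e.succ ≠ 0 → p e)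
    (hl : ∀ e, o e = false → β e.succ ≠ 0 → γ e.castSucc ≠ 0 → p e) (e : Fin m)
    (h1 : β ((typeA o).tail e) ≠ 0) (h2 : γ ((typeA o).head e) ≠ 0) : p e := by
  by_cases he : o e = true
  · simp only [typeA, he, if_true] at h1 h2
    exact hr e he h1 h2
  · rw [Bool.not_eq_true] at he
    simp only [typeA, he] at h1 h2
    exact hl e he h1 h2

/-- Each arrow from the support of `β` to that of `γ` gives an equation between the values of `f` at
its ends. Depending on the order of the rows, alignment ensures that the unknown at the right end,
or the one at the left end, occurs in it with coefficient `±1`. -/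
theorem thinExtVanishes_of_isRowSupport (hβ : IsRowSupport o d r β) (hγ : IsRowSupport o d r' γ) :
    ThinExtVanishes (typeA o) β γ := by
  intro η
  rcases lt_or_ge r' r with h | h
  -- `β` lies below `γ`: the right end can be solved for. The starting value `0` is arbitrary.
  · obtain ⟨f, hf⟩ : ∃ f : Fin (m + 1) → ℂ, ∀ e : Fin m, f e.succ =
        if o e then η e + (if γ e.castSucc ≠ 0 then f e.castSucc else 0)
        else (if β e.castSucc ≠ 0 then f e.castSucc else 0) - η e :=
      ⟨fun i => Fin.induction (motive := fun _ => ℂ) 0 (fun e x =>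
        if o e then η e + (if γ e.castSucc ≠ 0 then x else 0)
        else (if β e.castSucc ≠ 0 then x else 0) - η e) i, fun e => Fin.induction_succ ..⟩
    refine ⟨f, forall_arrow_typeA (fun e he h1 h2 => ?_) fun e he h1 h2 => ?_⟩
    · have h3 := isDot_succ_of_right he h.le (hβ.1 _ h1) (hγ.1 _ h2)
      rw [thinDefect_typeA_right he, if_pos ((hβ.2 e (hβ.1 _ h1) h3).mp h1), hf, if_pos he,
        add_sub_cancel_right]
    · have h3 := isDot_succ_of_left he h.le (hβ.1 _ h1) (hγ.1 _ h2)
      rw [thinDefect_typeA_left he, if_pos ((hγ.2 e (hγ.1 _ h2) h3).mp h2), hf,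
        he, if_neg Bool.false_ne_true, sub_sub_cancel]
  -- Otherwise the left end can be solved for, so the recursion runs from right to left.
  · obtain ⟨f, hf⟩ : ∃ f : Fin (m + 1) → ℂ, ∀ e : Fin m, f e.castSucc =
        if o e then (if β e.succ ≠ 0 then f e.succ else 0) - η e
        else η e + (if γ e.succ ≠ 0 then f e.succ else 0) :=
      ⟨fun i => Fin.reverseInduction (motive := fun _ => ℂ) 0 (fun e x =>
        if o e then (if β e.succ ≠ 0 then x else 0) - η e
        else η e + (if γ e.succ ≠ 0 then x else 0)) i,
        fun e => Fin.reverseInduction_castSucc ..⟩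
    refine ⟨f, forall_arrow_typeA (fun e he h1 h2 => ?_) fun e he h1 h2 => ?_⟩
    · have h3 := isDot_castSucc_of_right he h (hβ.1 _ h1) (hγ.1 _ h2)
      rw [thinDefect_typeA_right he, if_pos ((hγ.2 e h3 (hγ.1 _ h2)).mpr h2), hf, if_pos he,
        sub_sub_cancel]
    · have h3 := isDot_castSucc_of_left he h (hβ.1 _ h1) (hγ.1 _ h2)
      rw [thinDefect_typeA_left he, if_pos ((hβ.2 e h3 (hβ.1 _ h1)).mpr h1), hf,
        if_neg (by simp [he]), add_sub_cancel_right]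

theorem IsThinHom.eq_of_le {f : Fin (m + 1) → ℂ} (hf : IsThinHom (typeA o) β γ f)
    {i j : Fin (m + 1)} (hij : i ≤ j) (hβ : ∀ l, i ≤ l → l ≤ j → β l ≠ 0)
    (hγ : ∀ l, i ≤ l → l ≤ j → γ l ≠ 0) : f i = f j := by
  induction j using Fin.induction with
  | zero => rw [Fin.le_zero_iff.mp hij]
  | succ e ih =>
    rcases hij.eq_or_lt with rfl | hlt
    · rfl
    have h1 : i ≤ e.castSucc := Fin.le_castSucc_iff.mpr hlt
    have h2 : e.castSucc ≤ e.succ := e.castSucc_lt_succ.le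
    rw [ih h1 (fun l hl hl' => hβ l hl (hl'.trans h2)) fun l hl hl' => hγ l hl (hl'.trans h2)]
    have h3 := hβ _ h1 h2
    have h4 := hγ _ h1 h2
    have h5 := hβ _ hij le_rfl
    have h6 := hγ _ hij le_rfl
    have := hf e
    by_cases he : o e = true
    · rw [thinDefect_typeA_right he, if_pos h5, if_pos h4] at this
      simp only [typeA, he, if_true] at this
      exact (sub_eq_zero.mp (this h3 h6)).symm
    · rw [Bool.not_eq_true] at he
      rw [thinDefect_typeA_left he, if_pos h3, if_pos h6] at this
      simp only [typeA, he] at this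
      exact sub_eq_zero.mp (this h5 h4)

theorem IsIntervalSupport.isThinBrick (h : IsIntervalSupport β) : IsThinBrick (typeA o) β := by
  have key : ∀ f, IsThinHom (typeA o) β β f → ∀ x y, x ≤ y → β x ≠ 0 → β y ≠ 0 → f x = f y :=
    fun f hf x y hxy hx hy => hf.eq_of_le hxy (fun l h1 h2 => h x y l h1 h2 hx hy)
      fun l h1 h2 => h x y l h1 h2 hx hy
  intro f hf x y hx hy
  rcases le_total x y with hxy | hxy
  · exact key f hf x y hxy hx hy
  · exact (key f hf y x hxy hy hx).symm

/-! ### Connected components of the rows and the type A decomposition -/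

theorem component_ne_zero_iff {p j : Fin (m + 1)} : component o d r p j ≠ 0 ↔
    ∀ l, min p j ≤ l → l ≤ max p j → IsDot o d r l := by
  simp only [component, Finset.mem_Icc, and_imp, ne_eq, ite_eq_right_iff, one_ne_zero, imp_false,
    not_not]

theorem component_le_one (r : ℤ) (p j : Fin (m + 1)) : component o d r p j ≤ 1 := by
  rw [component]
  split_ifs <;> simp

theorem component_self {p : Fin (m + 1)} (h : IsDot o d r p) : component o d r p p ≠ 0 := by
  rw [component_ne_zero_iff]
  intro l h1 h2
  rw [min_self] at h1
  rw [max_self] at h2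
  rwa [le_antisymm h2 h1]

theorem component_comm (r : ℤ) (p q : Fin (m + 1)) :
    component o d r p q = component o d r q p := by
  rw [component, component, min_comm, max_comm]

theorem component_trans {p q l : Fin (m + 1)} (h1 : component o d r p q ≠ 0)
    (h2 : component o d r q l ≠ 0) : component o d r p l ≠ 0 := by
  rw [component_ne_zero_iff] at *
  intro i hi hi'
  by_cases h : min p q ≤ i ∧ i ≤ max p q
  · exact h1 i h.1 h.2
  · refine h2 i ?_ ?_ <;> simp only [Fin.le_def, Fin.coe_min, Fin.coe_max] at * <;> omega

theorem component_eq {p q : Fin (m + 1)} (h : component o d r p q ≠ 0) :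
    component o d r p = component o d r q := by
  ext j
  have h1 := component_le_one (o := o) (d := d) r p j
  have h2 := component_le_one (o := o) (d := d) r q j
  have h3 : component o d r p j ≠ 0 ↔ component o d r q j ≠ 0 :=
    ⟨component_trans (by rwa [component_comm]), component_trans h⟩
  omega

theorem isRowSupport_component (r : ℤ) (p : Fin (m + 1)) :
    IsRowSupport o d r (component o d r p) := by
  refine ⟨fun i hi => component_ne_zero_iff.mp hi i (min_le_right _ _) (le_max_right _ _),
    fun e h1 h2 => ?_⟩
  have h3 : component o d r e.castSucc e.succ ≠ 0 := by
    rw [component_ne_zero_iff]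
    intro l hl hl'
    have : l = e.castSucc ∨ l = e.succ := by
      simp only [Fin.le_def, Fin.ext_iff, Fin.coe_min, Fin.coe_max, Fin.val_succ,
        Fin.val_castSucc] at *
      omega
    rcases this with rfl | rfl <;> assumption
  exact ⟨fun h => component_trans h h3,
    fun h => component_trans h (by rwa [component_comm])⟩

theorem isIntervalSupport_component (r : ℤ) (p : Fin (m + 1)) :
    IsIntervalSupport (component o d r p) := by
  intro i j l hil hlj hi hj
  rw [component_eq hi] at hj ⊢
  rw [component_ne_zero_iff] at *
  intro t ht ht'
  refine hj t ?_ ?_ <;> simp only [Fin.le_def, Fin.coe_min, Fin.coe_max] at * <;> omega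

theorem isRowSupport_zero (r : ℤ) : IsRowSupport o d r 0 :=
  ⟨fun _ h => (h rfl).elim, fun _ _ _ => Iff.rfl⟩

theorem columnRows_eq (i : Fin (m + 1)) :
    columnRows o d i = (List.range (d i)).map fun j : ℕ => topRow o d i + (j : ℤ) := by
  simp only [columnRows, List.bind_eq_flatMap, List.pure_def, ← List.map_eq_flatMap,
    List.map_map, Function.comp_def]

theorem mem_columnRows {i : Fin (m + 1)} : r ∈ columnRows o d i ↔ IsDot o d r i := by
  simp only [columnRows_eq, List.mem_map, List.mem_range, IsDot]
  constructor
  · rintro ⟨j, hj, rfl⟩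
    omega
  · intro h
    exact ⟨(r - topRow o d i).toNat, by omega, by omega⟩

theorem exists_component_of_mem_diagramA (h : β ∈ diagramA o d) :
    ∃ r p, IsDot o d r p ∧ β = component o d r p := by
  simp only [diagramA, List.mem_flatMap, List.mem_map, List.mem_filter] at h
  obtain ⟨p, -, r, ⟨hr, -⟩, rfl⟩ := h
  exact ⟨r, p, mem_columnRows.mp hr, rfl⟩

theorem isRigidList_diagramA (o : Fin m → Bool) (d : Fin (m + 1) → ℕ) :
    IsRigidList (typeA o) (diagramA o d) := by
  refine ⟨(diagramA o d).map (thinCoordRep (typeA o)), ?_, ?_, ?_⟩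
  · rw [List.map_map, List.map_congr_left (g := id), List.map_id]
    intro β hβ
    obtain ⟨r, p, -, rfl⟩ := exists_component_of_mem_diagramA hβ
    exact dimVector_thinCoordRep (component_le_one r p)
  · simp only [List.mem_map, forall_exists_index, and_imp, forall_apply_eq_imp_iff₂]
    intro β hβ
    obtain ⟨r, p, hp, rfl⟩ := exists_component_of_mem_diagramA hβ
    exact isBrick_thinCoordRep ⟨p, component_self hp⟩ (isIntervalSupport_component r p).isThinBrick
  · simp only [List.mem_map, forall_exists_index, and_imp, forall_apply_eq_imp_iff₂]
    intro β hβ γ hγ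
    obtain ⟨r, p, -, rfl⟩ := exists_component_of_mem_diagramA hβ
    obtain ⟨r', p', -, rfl⟩ := exists_component_of_mem_diagramA hγ
    exact extVanishes_thinCoordRep
      (thinExtVanishes_of_isRowSupport (isRowSupport_component r p) (isRowSupport_component r' p'))

theorem exists_leftmost {p : Fin (m + 1)} (h : IsDot o d r p) :
    ∃ i, component o d r i p ≠ 0 ∧ ∀ j : Fin (m + 1), j.val + 1 = i.val → ¬ IsDot o d r j := by
  obtain ⟨i, hi, hmin⟩ := WellFounded.has_min (wellFounded_lt (α := Fin (m + 1)))
    {i | component o d r i p ≠ 0} ⟨p, component_self h⟩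
  -- A dot immediately to the left of `i` would belong to the same component, against minimality.
  refine ⟨i, hi, fun j hj hdot => hmin j ?_ (Fin.lt_def.mpr (by omega))⟩
  refine component_trans (q := i) ?_ hi
  rw [component_ne_zero_iff]
  intro l hl hl'
  have : l = j ∨ l = i := by
    simp only [Fin.le_def, Fin.ext_iff, Fin.coe_min, Fin.coe_max] at *
    omega
  rcases this with rfl | rfl
  · exact hdot
  · exact (isRowSupport_component (o := o) (d := d) r p).1 _ (by rwa [component_comm])

theorem leftmost_unique {i j p : Fin (m + 1)} (hi : component o d r i p ≠ 0)
    (hi' : ∀ j : Fin (m + 1), j.val + 1 = i.val → ¬ IsDot o d r j)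
    (hj : component o d r j p ≠ 0)
    (hj' : ∀ i : Fin (m + 1), i.val + 1 = j.val → ¬ IsDot o d r i) : i = j := by
  have key : ∀ i j : Fin (m + 1), component o d r i j ≠ 0 →
      (∀ i : Fin (m + 1), i.val + 1 = j.val → ¬ IsDot o d r i) → j ≤ i := by
    intro i j h h'
    by_contra! hlt
    rw [Fin.lt_def] at hlt
    refine h' ⟨j.val - 1, by omega⟩ (by simp only; omega) (component_ne_zero_iff.mp h _ ?_ ?_) <;>
      simp only [Fin.le_def, Fin.coe_min, Fin.coe_max] <;> omega
  have hij := component_trans hi (by rwa [component_comm] : component o d r p j ≠ 0)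
  exact le_antisymm (key j i (by rwa [component_comm]) hi') (key i j hij hj')

/-- Summing over all components through a given column. -/
theorem sum_diagramA (F : (Fin (m + 1) → ℕ) → ℕ) (p : Fin (m + 1)) :
    ((diagramA o d).map fun β => if β p ≠ 0 then F β else 0).sum =
      ((columnRows o d p).map fun r => F (component o d r p)).sum := by
  classical
  have hnodup : ∀ i, (columnRows o d i).Nodup := fun i => by
    rw [columnRows_eq]
    exact List.nodup_range.map fun a b h => by simpa using h
  have h1 : ∀ (i : Fin (m + 1)) (q : ℤ → Bool) (G : ℤ → ℕ),
      (((columnRows o d i).filter q).map G).sum =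
        ∑ r ∈ (columnRows o d i).toFinset with q r = true, G r := by
    intro i q G
    rw [← List.toFinset_filter, List.sum_toFinset _ ((hnodup i).filter _)]
  have h2 : ∀ G : ℤ → ℕ, ((columnRows o d p).map G).sum =
      ∑ r ∈ (columnRows o d p).toFinset, G r := fun G => (List.sum_toFinset _ (hnodup p)).symm
  rw [h2, diagramA, List.map_flatMap, List.flatMap_def, List.sum_flatten]
  simp only [List.map_map, Function.comp_def, h1]
  rw [← List.ofFn_eq_map, List.sum_ofFn, Finset.sum_sigma']
  simp only [← Finset.sum_filter]
  -- A component through column `p` is determined by its row; the inverse sends a row to the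
  -- leftmost dot of its component.
  refine Finset.sum_bij (fun x _ => x.2) ?_ ?_ ?_ ?_
  · rintro ⟨i, r⟩ h
    simp only [Finset.mem_filter, Finset.mem_sigma, List.mem_toFinset, mem_columnRows] at h ⊢
    exact (isRowSupport_component r i).1 _ h.2
  · rintro ⟨i, r⟩ h ⟨j, r'⟩ h' (rfl : r = r')
    simp only [Finset.mem_filter, Finset.mem_sigma, decide_eq_true_eq] at h h'
    rw [leftmost_unique h.2 h.1.2.2 h'.2 h'.1.2.2]
  · intro r hr
    rw [List.mem_toFinset, mem_columnRows] at hr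
    obtain ⟨i, hi, hi'⟩ := exists_leftmost hr
    refine ⟨⟨i, r⟩, ?_, rfl⟩
    simp only [Finset.mem_filter, Finset.mem_sigma, List.mem_toFinset, mem_columnRows,
      decide_eq_true_eq]
    exact ⟨⟨Finset.mem_univ _, (isRowSupport_component r p).1 _ (by rwa [component_comm]), hi'⟩, hi⟩
  · rintro ⟨i, r⟩ h
    simp only [Finset.mem_filter] at h
    rw [component_eq h.2]

theorem List.sum_apply' {ι : Type} (l : List (ι → ℕ)) (i : ι) :
    l.sum i = (l.map fun β => β i).sum := by
  induction l with
  | nil => rfl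
  | cons a l ih => simp [ih]

theorem diagramA_sum (o : Fin m → Bool) (d : Fin (m + 1) → ℕ) : (diagramA o d).sum = d := by
  ext p
  rw [List.sum_apply']
  -- With constant weight one, this counts the dots of column `p`.
  have h := sum_diagramA (o := o) (d := d) (fun _ => 1) p
  simp only [List.map_const', List.sum_replicate, columnRows_eq, List.length_map,
    List.length_range, smul_eq_mul, mul_one] at h
  rw [← h]
  congr 1
  refine List.map_congr_left fun β hβ => ?_
  obtain ⟨r, q, -, rfl⟩ := exists_component_of_mem_diagramA hβ
  have := component_le_one (o := o) (d := d) r q p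
  split_ifs <;> omega

end TypeA

/-! ### Representations in type D with dimension at most two -/

section PairRep

variable {k : ℕ} {o : Fin (k + 2) → Bool}

/-- The basis elements at a vertex: `p b` is the support on the vertices `1, …, n - 1` of the basis
elements with label `b`, and `ε` the dimension at the vertex `n`. -/
def pairBasis (p : Bool → Fin (k + 3) → ℕ) (ε : ℕ) (x : Fin (k + 4)) : Finset Bool :=
  Finset.univ.filter fun b => Fin.snoc (α := fun _ => ℕ) (p b) (if b then ε else 0) x ≠ 0

theorem mem_pairBasis_castSucc {p : Bool → Fin (k + 3) → ℕ} {ε : ℕ} {i : Fin (k + 3)} {b : Bool} :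
    b ∈ pairBasis p ε i.castSucc ↔ p b i ≠ 0 := by
  simp [pairBasis]

theorem mem_pairBasis_last {p : Bool → Fin (k + 3) → ℕ} {ε : ℕ} {b : Bool} :
    b ∈ pairBasis p ε (Fin.last (k + 3)) ↔ b = true ∧ ε ≠ 0 := by
  cases b <;> simp [pairBasis]

/-- The matrix entries: the arrows in type A preserve the label of the basis elements, and the
arrow `2 → n` sends all basis elements at `2` to the one at `n`. -/
def pairCoeff : Fin (k + 2) ⊕ Unit → Bool → Bool → ℂ
  | Sum.inl _, t, s => if s = t then 1 else 0
  | Sum.inr _, _, _ => 1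

/-- The representation which extends the direct sum of two thin representations of type A by a
space of dimension `ε` (zero or one) at the vertex `n`. -/
noncomputable def pairRep (o : Fin (k + 2) → Bool) (p : Bool → Fin (k + 3) → ℕ) (ε : ℕ) :
    QRep (typeD o true) :=
  coordRep (typeD o true) (pairBasis p ε) pairCoeff

theorem dimVector_pairRep {p : Bool → Fin (k + 3) → ℕ} {ε : ℕ} (hp : ∀ b i, p b i ≤ 1)
    (hε : ε ≤ 1) :
    (pairRep o p ε).dimVector = Fin.snoc (α := fun _ => ℕ) (p true + p false) ε := by
  rw [pairRep, dimVector_coordRep]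
  ext x
  rw [pairBasis, Finset.card_filter, Fintype.sum_bool]
  induction x using Fin.lastCases with
  | last => simp only [Fin.snoc_last]; interval_cases ε <;> simp
  | cast i =>
    simp only [Fin.snoc_castSucc, Pi.add_apply]
    have h1 := hp true i
    have h2 := hp false i
    split_ifs <;> omega

variable {p q : Bool → Fin (k + 3) → ℕ} {ε δ : ℕ}

theorem coordDefect_inl (F : Fin (k + 4) → Bool → Bool → ℂ) (e : Fin (k + 2)) (t s : Bool) :
    coordDefect (pairBasis p ε) pairCoeff (pairBasis q δ) pairCoeff (typeD o true) F (Sum.inl e) t s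
      = thinDefect (typeA o) (p s) (q t) (fun i => F i.castSucc t s) e := by
  simp only [coordDefect, thinDefect, typeD, pairCoeff, mul_ite, ite_mul, mul_one, one_mul,
    mul_zero, zero_mul, Finset.sum_ite_eq, mem_pairBasis_castSucc, eq_comm]

theorem coordDefect_inr (F : Fin (k + 4) → Bool → Bool → ℂ) (t s : Bool) :
    coordDefect (pairBasis p ε) pairCoeff (pairBasis q δ) pairCoeff (typeD o true) F
      (Sum.inr ()) t s = (if ε ≠ 0 then F (Fin.last _) t true else 0) -
        ∑ u, if q u 1 ≠ 0 then F (1 : Fin (k + 3)).castSucc u s else 0 := by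
  simp only [coordDefect, typeD, pairCoeff, if_true, mul_one, one_mul, pairBasis,
    Finset.sum_filter, Fintype.sum_bool, Fin.snoc_last, Fin.snoc_castSucc]
  simp

/-- Either `β` vanishes at vertex `2` or there is a morphism to one of the thin representations
given by `q` which is not zero there. -/
def IsAbsorbedBy (o : Fin (k + 2) → Bool) (q : Bool → Fin (k + 3) → ℕ) (β : Fin (k + 3) → ℕ) :
    Prop :=
  β 1 = 0 ∨ ∃ b, ThinHomAt (typeA o) 1 β (q b)

/-- The given morphism is used for one summand of the target and zero for the other, so the total
contribution at vertex `2` is one. -/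
theorem IsAbsorbedBy.exists_homs {β : Fin (k + 3) → ℕ} (h : IsAbsorbedBy o q β) :
    ∃ H : Bool → Fin (k + 3) → ℂ, (∀ b, IsThinHom (typeA o) β (q b) (H b)) ∧
      (β 1 ≠ 0 → ∑ u, (if q u 1 ≠ 0 then H u 1 else 0) = 1) := by
  have h0 : ∀ b, IsThinHom (typeA o) β (q b) 0 := fun b a _ _ => by simp [thinDefect]
  rcases h with h | ⟨b, -, hb, f, hf, hf1⟩
  · exact ⟨0, h0, fun h' => (h' h).elim⟩
  · refine ⟨fun u => if u = b then f else 0, fun u => ?_, fun _ => ?_⟩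
    · dsimp only
      split_ifs with hu
      · exact hu ▸ hf
      · exact h0 u
    · rw [Finset.sum_eq_single b]
      · simp [hb, hf1]
      · intro u _ hu
        simp [hu]
      · simp

theorem thinDefect_add_mul {X A : Type} {Q : QuiverData X A} (β γ : X → ℕ) (f g : X → ℂ) (c : ℂ)
    (a : A) : thinDefect Q β γ (fun x => f x + c * g x) a =
      thinDefect Q β γ f a + c * thinDefect Q β γ g a := by
  simp only [thinDefect]
  split_ifs <;> ring

/-- The type A equations are solved by `g`, up to adding multiples `c s` of morphisms `H s`. The
last arrow imposes one equation per label `s`, with residual `c s`: an absorbed label is corrected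
through `H s`, and the only possibly unabsorbed label `b` through the scalar `y` at vertex `n`. -/
theorem extVanishes_pairRep (hpq : ∀ b b', ThinExtVanishes (typeA o) (p b) (q b'))
    (h : δ ≠ 0 → ∃ b, (ε ≠ 0 ∨ IsAbsorbedBy o q (p b)) ∧ IsAbsorbedBy o q (p !b)) :
    (pairRep o p ε).ExtVanishes (pairRep o q δ) := by
  refine extVanishes_coordRep fun η => ?_
  choose g hg using fun b b' => hpq b b' fun e => η (Sum.inl e) b' b
  by_cases hδ : δ = 0
  · refine ⟨fun x t s => Fin.snoc (α := fun _ => ℂ) (g s t) 0 x, fun a s hs t ht => ?_⟩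
    rcases a with e | ⟨⟩
    · rw [coordDefect_inl]
      simp only [Fin.snoc_castSucc]
      exact hg s t e (mem_pairBasis_castSucc.mp hs) (mem_pairBasis_castSucc.mp ht)
    · exact ((mem_pairBasis_last.mp ht).2 hδ).elim
  obtain ⟨b, hb, hb'⟩ := h hδ
  -- `y` makes the residual of the label `b` vanish; it must be zero when the source has nothing at
  -- `n`.
  let y : ℂ := if ε ≠ 0 then η (Sum.inr ()) true b + ∑ u, (if q u 1 ≠ 0 then g b u 1 else 0) else 0
  let c : Bool → ℂ := fun s => y - η (Sum.inr ()) true s - ∑ u, if q u 1 ≠ 0 then g s u 1 else 0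
  have hH : ∀ s, ∃ H : Bool → Fin (k + 3) → ℂ, (∀ b, IsThinHom (typeA o) (p s) (q b) (H b)) ∧
      (p s 1 ≠ 0 → c s * ∑ u, (if q u 1 ≠ 0 then H u 1 else 0) = c s) := by
    intro s
    by_cases hs : IsAbsorbedBy o q (p s)
    · obtain ⟨H, hH, hH1⟩ := hs.exists_homs
      exact ⟨H, hH, fun h => by rw [hH1 h, mul_one]⟩
    · refine ⟨0, fun b a _ _ => by simp [thinDefect], fun _ => ?_⟩
      have hsb : s = b := by
        by_contra hne
        rw [Bool.eq_not_iff.mpr hne] at hs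
        exact hs hb'
      subst hsb
      have hc : c s = 0 := by simp [c, y, hb.resolve_right hs]
      rw [hc, zero_mul]
  choose H hH hH1 using hH
  refine ⟨fun x t s => Fin.snoc (α := fun _ => ℂ) (fun i => g s t i + c s * H s t i) y x,
    fun a s hs t ht => ?_⟩
  rcases a with e | ⟨⟩
  · rw [coordDefect_inl]
    have h1 := mem_pairBasis_castSucc.mp hs
    have h2 := mem_pairBasis_castSucc.mp ht
    simp only [Fin.snoc_castSucc, thinDefect_add_mul]
    rw [hg s t e h1 h2, hH s t e h1 h2, mul_zero, add_zero]
  · obtain ⟨rfl, -⟩ := mem_pairBasis_last.mp ht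
    have h1 : p s 1 ≠ 0 := mem_pairBasis_castSucc.mp hs
    have h2 := hH1 s h1
    have h3 : (if ε ≠ 0 then y else 0) = y := by
      by_cases hε : ε = 0 <;> simp [hε, y]
    have h4 : (∑ u, if q u 1 ≠ 0 then g s u 1 + c s * H s u 1 else 0) =
        (∑ u, if q u 1 ≠ 0 then g s u 1 else 0) + c s * ∑ u, if q u 1 ≠ 0 then H s u 1 else 0 := by
      rw [Finset.mul_sum, ← Finset.sum_add_distrib]
      exact Finset.sum_congr rfl fun u _ => by split_ifs <;> simp
    rw [coordDefect_inr]
    simp only [Fin.snoc_castSucc, Fin.snoc_last]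
    rw [h3, h4, h2]
    simp only [c]
    ring

theorem thinHom_of_pairRep {F : Fin (k + 4) → Bool → Bool → ℂ}
    (hF : ∀ a, ∀ s ∈ pairBasis p ε ((typeD o true).tail a),
      ∀ t ∈ pairBasis p ε ((typeD o true).head a),
        coordDefect (pairBasis p ε) pairCoeff (pairBasis p ε) pairCoeff (typeD o true) F a t s = 0)
    (s t : Bool) : IsThinHom (typeA o) (p s) (p t) fun i => F i.castSucc t s := by
  intro e h1 h2
  rw [← coordDefect_inl (ε := ε) (δ := ε)]
  exact hF (Sum.inl e) s (mem_pairBasis_castSucc.mpr h1) t (mem_pairBasis_castSucc.mpr h2)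

theorem isBrick_pairRep_one (hp : ∀ b, IsThinBrick (typeA o) (p b))
    (hp1 : ∀ b i, p b i ≠ 0 → p b 1 ≠ 0)
    (hhom : ∀ b f, IsThinHom (typeA o) (p b) (p !b) f → ∀ i, p b i ≠ 0 → p (!b) i ≠ 0 → f i = 0) :
    (pairRep o p 1).IsBrick := by
  refine isBrick_coordRep ⟨Fin.last _, true, by simp [mem_pairBasis_last]⟩ fun F hF => ?_
  have hoff : ∀ s t, s ≠ t → ∀ i, p s i ≠ 0 → p t i ≠ 0 → F i.castSucc t s = 0 := by
    intro s t hst i hs ht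
    obtain rfl : t = !s := Bool.eq_not_iff.mpr hst.symm
    exact hhom s _ (thinHom_of_pairRep hF _ _) i hs ht
  refine ⟨F (Fin.last _) true true, fun x s hs t ht => ?_⟩
  induction x using Fin.lastCases with
  | last =>
    obtain ⟨rfl, -⟩ := mem_pairBasis_last.mp hs
    obtain ⟨rfl, -⟩ := mem_pairBasis_last.mp ht
    rfl
  | cast i =>
    rw [mem_pairBasis_castSucc] at hs ht
    split_ifs with hst
    · subst hst
      have h1 := hp1 s i hs
      rw [hp s _ (thinHom_of_pairRep hF s s) i 1 hs h1]
      have h2 := hF (Sum.inr ()) s (mem_pairBasis_castSucc.mpr h1) true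
        (mem_pairBasis_last.mpr ⟨rfl, one_ne_zero⟩)
      rw [coordDefect_inr, if_pos one_ne_zero, Finset.sum_eq_single s, if_pos h1,
        sub_eq_zero] at h2
      · exact h2.symm
      · intro u _ hu
        split_ifs with hu1
        · exact hoff s u hu.symm 1 h1 hu1
        · rfl
      · simp
    · exact hoff s t hst i hs ht

theorem isBrick_pairRep_zero {β : Fin (k + 3) → ℕ} (hβ : IsThinBrick (typeA o) β)
    (h0 : ∃ i, β i ≠ 0) : (pairRep o (fun b => if b then β else 0) 0).IsBrick := by
  obtain ⟨i, hi⟩ := h0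
  refine isBrick_coordRep ⟨i.castSucc, true, by simpa [mem_pairBasis_castSucc] using hi⟩
    fun F hF => ⟨F i.castSucc true true, fun x s hs t ht => ?_⟩
  induction x using Fin.lastCases with
  | last => exact ((mem_pairBasis_last.mp hs).2 rfl).elim
  | cast j =>
    rw [mem_pairBasis_castSucc] at hs ht
    cases s with
    | false => exact (hs rfl).elim
    | true =>
      cases t with
      | false => exact (ht rfl).elim
      | true => exact hβ _ (thinHom_of_pairRep hF true true) j i hs hi

end PairRep

/-! ### Morphisms between the components through vertex `2` -/

section Classes

variable {k : ℕ} {o : Fin (k + 2) → Bool} {d : Fin (k + 3) → ℕ} {β γ : Fin (k + 3) → ℕ}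

/-- The constant function one is a morphism. To the right of vertex `2`, alignment lets the lower
component map to the higher one; on the arrow between vertices `1` and `2` the equality of the two
supports at `1` is what is needed. -/
theorem thinHomAt_of_le {r r' : ℤ} (h : r' ≤ r) (hβ : IsRowSupport o d r β)
    (hγ : IsRowSupport o d r' γ) (hβi : IsIntervalSupport β) (hγi : IsIntervalSupport γ)
    (hβ1 : β 1 ≠ 0) (hγ1 : γ 1 ≠ 0) (h0 : β 0 ≠ 0 ↔ γ 0 ≠ 0) : ThinHomAt (typeA o) 1 β γ := by
  refine ⟨hβ1, hγ1, fun _ => 1, forall_arrow_typeA (fun e he h1 h2 => ?_)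
    fun e he h1 h2 => ?_, rfl⟩
  · rw [thinDefect_typeA_right he]
    have h3 : γ e.castSucc ≠ 0 := by
      by_cases he0 : e = 0
      · subst he0
        exact h0.mp h1
      · exact hγi 1 e.succ e.castSucc (Fin.one_le_of_ne_zero (by
          simpa using he0)) e.castSucc_lt_succ.le hγ1 h2
    have h4 := isDot_succ_of_right he h (hβ.1 _ h1) (hγ.1 _ h2)
    rw [if_pos ((hβ.2 e (hβ.1 _ h1) h4).mp h1), if_pos h3, sub_self]
  · rw [thinDefect_typeA_left he]
    have h3 : β e.castSucc ≠ 0 := by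
      by_cases he0 : e = 0
      · subst he0
        exact h0.mpr h2
      · exact hβi 1 e.succ e.castSucc (Fin.one_le_of_ne_zero (by
          simpa using he0)) e.castSucc_lt_succ.le hβ1 h1
    have h4 := isDot_succ_of_left he h (hβ.1 _ h1) (hγ.1 _ h2)
    rw [if_pos h3, if_pos ((hγ.2 e (hγ.1 _ h2) h4).mp h2), sub_self]

theorem IsThinHom.eq_at_one {f : Fin (k + 3) → ℂ} (hf : IsThinHom (typeA o) β γ f)
    (hβi : IsIntervalSupport β) (hγi : IsIntervalSupport γ) (hβ1 : β 1 ≠ 0) (hγ1 : γ 1 ≠ 0)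
    {i : Fin (k + 3)} (hi : i ≠ 0) (hβ : β i ≠ 0) (hγ : γ i ≠ 0) : f 1 = f i :=
  hf.eq_of_le (Fin.one_le_of_ne_zero hi) (fun l h1 h2 => hβi 1 i l h1 h2 hβ1 hβ)
    fun l h1 h2 => hγi 1 i l h1 h2 hγ1 hγ

theorem thinHomAt_of_hasNonzeroHom (hβ : ∀ i, β i ≤ 1) (hγ : ∀ i, γ i ≤ 1)
    (hβi : IsIntervalSupport β) (hγi : IsIntervalSupport γ) (hβ1 : β 1 ≠ 0)
    (hγ1 : γ ≠ 0 → γ 1 ≠ 0) (h0 : β 0 = 0 ∨ γ 0 = 0)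
    (h : (thinRep (typeA o) β).toQRep.HasNonzeroHom (thinRep (typeA o) γ).toQRep) :
    ThinHomAt (typeA o) 1 β γ := by
  obtain ⟨f, i, hf, hβx, hγx, hfx⟩ := exists_isThinHom_of_hasNonzeroHom hβ hγ h
  have hγ1 := hγ1 fun h => hγx (congrFun h i)
  have hi : i ≠ 0 := by
    rintro rfl
    tauto
  rw [← hf.eq_at_one hβi hγi hβ1 hγ1 hi hβx hγx] at hfx
  -- Rescale to the value one at vertex `2`; the summand `0` matches the form of
  -- `thinDefect_add_mul`.
  refine ⟨hβ1, hγ1, fun x => 0 + (f 1)⁻¹ * f x, fun a h1 h2 => ?_, ?_⟩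
  · rw [thinDefect_add_mul _ _ (fun _ => 0), hf a h1 h2]
    simp [thinDefect]
  · simp [hfx]

/-- For `β` of the first class and `γ` of the second, the arrow between vertices `1` and `2` forces
the value at `2` to be zero, and this propagates along the common support. -/
theorem isThinHom_eq_zero (hβi : IsIntervalSupport β) (hγi : IsIntervalSupport γ) (hβ1 : β 1 ≠ 0)
    (hγ1 : γ 1 ≠ 0) (h0 : if o 0 then β 0 ≠ 0 ∧ γ 0 = 0 else β 0 = 0 ∧ γ 0 ≠ 0)
    {f : Fin (k + 3) → ℂ} (hf : IsThinHom (typeA o) β γ f) {i : Fin (k + 3)} (hβ : β i ≠ 0)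
    (hγ : γ i ≠ 0) : f i = 0 := by
  have hi : i ≠ 0 := by
    rintro rfl
    split_ifs at h0 <;> tauto
  rw [← hf.eq_at_one hβi hγi hβ1 hγ1 hi hβ hγ]
  have h1 := hf 0
  by_cases ho : o 0 = true
  · rw [thinDefect_typeA_right ho] at h1
    simp only [ho, if_true] at h0
    simp only [typeA, ho, if_true] at h1
    have h2 := h1 h0.1 hγ1
    rw [if_pos (by exact hβ1), if_neg (by simpa using h0.2), sub_zero] at h2
    exact h2
  · rw [Bool.not_eq_true] at ho
    rw [thinDefect_typeA_left ho] at h1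
    rw [ho, if_neg Bool.false_ne_true] at h0
    simp only [typeA, ho] at h1
    have h2 := h1 hβ1 h0.2
    rw [if_neg (by simpa using h0.1), if_pos (by exact hγ1), zero_sub, neg_eq_zero] at h2
    exact h2

end Classes

/-! ### The procedure -/

section ProcedureProof

variable {k : ℕ} {o : Fin (k + 2) → Bool} {d : Fin (k + 3) → ℕ} {β γ : Fin (k + 3) → ℕ}

/-- The supports of the two summands of a row. -/
def rowSupport (p : (Fin (k + 3) → ℕ) × (Fin (k + 3) → ℕ)) : Bool → Fin (k + 3) → ℕ :=
  fun b => if b then p.1 else p.2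

theorem isAbsorbedBy_rowSupport_left {p : (Fin (k + 3) → ℕ) × (Fin (k + 3) → ℕ)}
    (h : ThinHomAt (typeA o) 1 β p.1) : IsAbsorbedBy o (rowSupport p) β :=
  Or.inr ⟨true, h⟩

theorem isAbsorbedBy_rowSupport_right {p : (Fin (k + 3) → ℕ) × (Fin (k + 3) → ℕ)}
    (h : ThinHomAt (typeA o) 1 β p.2) : IsAbsorbedBy o (rowSupport p) β :=
  Or.inr ⟨false, h⟩

theorem moveSecondClass_sum (R W : List (Fin (k + 3) → ℕ)) :
    (moveSecondClass o R W).1.sum + (moveSecondClass o R W).2.sum = R.sum + W.sum := by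
  induction R generalizing W with
  | nil => simp [moveSecondClass]
  | cons v R ih =>
    cases W with
    | nil => simp [moveSecondClass]
    | cons w W =>
      rw [moveSecondClass]
      split_ifs
      · rfl
      · have := ih W
        simp only [List.sum_cons]
        calc _ = v + w + ((moveSecondClass o R W).1.sum + (moveSecondClass o R W).2.sum) := by abel
          _ = _ := by rw [this]; abel

theorem moveSecondClass_length (R W : List (Fin (k + 3) → ℕ)) :
    (moveSecondClass o R W).1.length = R.length := by
  induction R generalizing W with
  | nil => simp [moveSecondClass]
  | cons v R ih =>
    cases W with
    | nil => simp [moveSecondClass]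
    | cons w W =>
      rw [moveSecondClass]
      split_ifs
      · rfl
      · simp [ih W]

/-- Rows are listed upwards and the second class downwards. Hence the first-class part of an earlier
row maps to that of a later one, while the second-class part of a later row maps to that of an
earlier one; empty parts are absorbed trivially. -/
theorem exists_rows_moveSecondClass (R W : List (Fin (k + 3) → ℕ))
    (hR : R.Pairwise fun v v' => v = 0 ∨ ThinHomAt (typeA o) 1 v v')
    (hW : W.Pairwise fun w w' => ThinHomAt (typeA o) 1 w' w)
    (hWW : ∀ w ∈ W, ThinHomAt (typeA o) 1 w w)
    (hWR : ∀ w ∈ W, ∀ v ∈ R,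
      (thinRep (typeA o) w).toQRep.HasNonzeroHom (thinRep (typeA o) v).toQRep →
        ThinHomAt (typeA o) 1 w v) :
    ∃ P : List ((Fin (k + 3) → ℕ) × (Fin (k + 3) → ℕ)),
      P.map (fun p => p.1 + p.2) = (moveSecondClass o R W).1 ∧
      (∀ p ∈ P, p.1 ∈ R ∧ (p.2 = 0 ∨ p.2 ∈ W ∧
        ¬ (thinRep (typeA o) p.2).toQRep.HasNonzeroHom (thinRep (typeA o) p.1).toQRep)) ∧
      (∀ w ∈ (moveSecondClass o R W).2, w ∈ W ∧ ∀ p ∈ P, IsAbsorbedBy o (rowSupport p) w) ∧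
      ∀ p ∈ P, ∀ q ∈ P, ∃ b, IsAbsorbedBy o (rowSupport q) (rowSupport p b) := by
  have hunmoved : ∀ R : List (Fin (k + 3) → ℕ),
      (R.map fun v => (v, (0 : Fin (k + 3) → ℕ))).map (fun p => p.1 + p.2) = R := fun R => by
    rw [List.map_map, List.map_congr_left (g := id), List.map_id]
    intro v _
    exact add_zero v
  induction R generalizing W with
  | nil => exact ⟨[], by simp [moveSecondClass]⟩
  | cons v R ih =>
    cases W with
    | nil =>
      refine ⟨(v :: R).map fun v => (v, 0), by rw [hunmoved, moveSecondClass], ?_, ?_, ?_⟩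
      · simp only [List.mem_map, forall_exists_index, and_imp, forall_apply_eq_imp_iff₂]
        exact fun u hu => ⟨hu, Or.inl trivial⟩
      · simp [moveSecondClass]
      · simp only [List.mem_map, forall_exists_index, and_imp, forall_apply_eq_imp_iff₂]
        exact fun _ _ _ _ => ⟨false, Or.inl rfl⟩
    | cons w W =>
      rw [List.pairwise_cons] at hR hW
      rw [moveSecondClass]
      split_ifs with hwv
      -- Stop rule (c): a later component maps to `w`, hence to `v`, hence to every higher row.
      · have h1 := hWR w List.mem_cons_self v List.mem_cons_self hwv
        refine ⟨(v :: R).map fun v => (v, 0), hunmoved _, ?_, ?_, ?_⟩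
        · simp only [List.mem_map, forall_exists_index, and_imp, forall_apply_eq_imp_iff₂]
          exact fun u hu => ⟨hu, Or.inl trivial⟩
        · simp only [List.mem_map, forall_exists_index, and_imp, forall_apply_eq_imp_iff₂]
          refine fun w' hw' => ⟨hw', fun v' hv' => isAbsorbedBy_rowSupport_left ?_⟩
          have h2 : ThinHomAt (typeA o) 1 w' v := by
            rcases List.mem_cons.mp hw' with rfl | hw'
            · exact h1
            · exact (hW.1 w' hw').trans h1
          rcases List.mem_cons.mp hv' with rfl | hv'
          · exact h2
          -- The row where the procedure stops is not empty, because it receives a non-zero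
          -- morphism.
          · refine h2.trans ((hR.1 v' hv').resolve_left ?_)
            rintro rfl
            exact h1.2.1 rfl
        · simp only [List.mem_map, forall_exists_index, and_imp, forall_apply_eq_imp_iff₂]
          exact fun _ _ _ _ => ⟨false, Or.inl rfl⟩
      · obtain ⟨P, hP1, hP2, hP3, hP4⟩ := ih W hR.2 hW.2
          (fun w' hw' => hWW w' (List.mem_cons_of_mem _ hw'))
          (fun w' hw' v' hv' => hWR w' (List.mem_cons_of_mem _ hw') v' (List.mem_cons_of_mem _ hv'))
        refine ⟨(v, w) :: P, by rw [List.map_cons, hP1], ?_, ?_, ?_⟩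
        · intro p hp
          rcases List.mem_cons.mp hp with rfl | hp
          · exact ⟨List.mem_cons_self, Or.inr ⟨List.mem_cons_self, hwv⟩⟩
          · obtain ⟨h1, h2⟩ := hP2 p hp
            exact ⟨List.mem_cons_of_mem _ h1, h2.imp_right (And.imp_left (List.mem_cons_of_mem _))⟩
        · intro w' hw'
          obtain ⟨h1, h2⟩ := hP3 w' hw'
          refine ⟨List.mem_cons_of_mem _ h1, fun p hp => ?_⟩
          rcases List.mem_cons.mp hp with rfl | hp
          · exact isAbsorbedBy_rowSupport_right (hW.1 w' h1)
          · exact h2 p hp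
        · intro p hp q hq
          rcases List.mem_cons.mp hq with rfl | hq
          -- Towards the bottom row, the second-class part of any row maps to `w`.
          · refine ⟨false, ?_⟩
            rcases List.mem_cons.mp hp with rfl | hp
            · exact isAbsorbedBy_rowSupport_right (hWW w List.mem_cons_self)
            · rcases (hP2 p hp).2 with h0 | ⟨h0, -⟩
              · exact Or.inl (congrFun h0 1)
              · exact isAbsorbedBy_rowSupport_right (hW.1 p.2 h0)
          · rcases List.mem_cons.mp hp with rfl | hp
            -- From the bottom row upwards, the first-class part maps.
            · refine ⟨true, ?_⟩
              rcases hR.1 q.1 (hP2 q hq).1 with h0 | h0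
              · exact Or.inl (congrFun h0 1)
              · exact isAbsorbedBy_rowSupport_left h0
            · exact hP4 p hp q hq

theorem exists_component_of_mem_innerPart (h : β ∈ innerPart o d) :
    ∃ r, IsDot o d r 1 ∧ β = component o d r 1 := by
  simp only [innerPart, List.mem_map] at h
  obtain ⟨r, hr, rfl⟩ := h
  exact ⟨r, mem_columnRows.mp hr, rfl⟩

theorem pairwise_innerPart (o : Fin (k + 2) → Bool) (d : Fin (k + 3) → ℕ) :
    (innerPart o d).Pairwise fun β γ => β 0 = γ 0 → ThinHomAt (typeA o) 1 γ β := by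
  rw [innerPart, List.pairwise_map, columnRows_eq, List.pairwise_map]
  refine List.Pairwise.imp_of_mem ?_ List.pairwise_lt_range
  intro i j hi hj hij h0
  rw [List.mem_range] at hi hj
  refine thinHomAt_of_le (by omega) (isRowSupport_component _ _) (isRowSupport_component _ _)
    (isIntervalSupport_component _ _) (isIntervalSupport_component _ _)
    (component_self ?_) (component_self ?_) (by rw [h0]) <;> rw [IsDot] <;> omega

theorem pairwise_filter_innerPart (o : Fin (k + 2) → Bool) (d : Fin (k + 3) → ℕ) (c : ℕ) :
    ((innerPart o d).filter fun β => β 0 = c).Pairwise fun β γ => ThinHomAt (typeA o) 1 γ β := by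
  refine List.Pairwise.imp_of_mem ?_ ((pairwise_innerPart o d).filter _)
  intro β γ hβ hγ h
  simp only [List.mem_filter, decide_eq_true_eq] at hβ hγ
  exact h (hβ.2.trans hγ.2.symm)

theorem pairwise_firstClass (o : Fin (k + 2) → Bool) (d : Fin (k + 3) → ℕ) :
    (firstClass o d).Pairwise fun β γ => ThinHomAt (typeA o) 1 γ β :=
  pairwise_filter_innerPart o d _

theorem pairwise_secondClass (o : Fin (k + 2) → Bool) (d : Fin (k + 3) → ℕ) :
    (secondClass o d).Pairwise fun β γ => ThinHomAt (typeA o) 1 γ β :=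
  pairwise_filter_innerPart o d _

theorem thinHomAt_of_lt_firstClass {i j : ℕ} (hij : i < j) (hj : j < (firstClass o d).length) :
    ThinHomAt (typeA o) 1 (firstClass o d)[j] ((firstClass o d).getD i 0) := by
  rw [List.getD_eq_getElem _ _ (hij.trans hj)]
  exact List.pairwise_iff_getElem.mp (pairwise_firstClass o d) i j _ _ hij

/-- Empty rows lie at the bottom, so after reversal they come first; this is why the alternative
concerns `v` and not `v'`. -/
theorem pairwise_middleRows (o : Fin (k + 2) → Bool) (d : Fin (k + 3) → ℕ) (c : ℕ) :
    (middleRows o d c).reverse.Pairwise fun v v' => v = 0 ∨ ThinHomAt (typeA o) 1 v v' := by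
  rw [List.pairwise_reverse, middleRows, List.pairwise_map]
  refine List.Pairwise.imp ?_ List.pairwise_lt_range
  intro i j hij
  rcases lt_or_ge j (firstClass o d).length with hj | hj
  · rw [List.getD_eq_getElem _ _ hj]
    exact Or.inr (thinHomAt_of_lt_firstClass hij hj)
  · exact Or.inl (List.getD_eq_default _ _ hj)

theorem mem_middleRows {c : ℕ} (h : β ∈ middleRows o d c) : β = 0 ∨ β ∈ firstClass o d := by
  simp only [middleRows, List.mem_map] at h
  obtain ⟨j, -, rfl⟩ := h
  rcases lt_or_ge j (firstClass o d).length with hj | hj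
  · rw [List.getD_eq_getElem _ _ hj]
    exact Or.inr (List.getElem_mem hj)
  · exact Or.inl (List.getD_eq_default _ _ hj)

/-- If a component of the first class remains below the bottom line, no middle row is empty, and all
of them lie above it. -/
theorem thinHomAt_of_mem_drop {c : ℕ} (hβ : β ∈ (firstClass o d).drop c)
    (hγ : γ ∈ middleRows o d c) : ThinHomAt (typeA o) 1 β γ := by
  obtain ⟨j, hj, rfl⟩ := List.mem_iff_getElem.mp hβ
  simp only [middleRows, List.mem_map, List.mem_range] at hγ
  obtain ⟨i, hi, rfl⟩ := hγ
  rw [List.getElem_drop]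
  exact thinHomAt_of_lt_firstClass (by omega) _

/-- The properties of the supports of the components of the diagram, and of the empty support. -/
def IsDiagramSupport (o : Fin (k + 2) → Bool) (d : Fin (k + 3) → ℕ) (β : Fin (k + 3) → ℕ) : Prop :=
  (∃ r, IsRowSupport o d r β) ∧ IsIntervalSupport β ∧ ∀ i, β i ≤ 1

theorem isDiagramSupport_component (r : ℤ) (p : Fin (k + 3)) :
    IsDiagramSupport o d (component o d r p) :=
  ⟨⟨r, isRowSupport_component r p⟩, isIntervalSupport_component r p, component_le_one r p⟩

theorem isDiagramSupport_zero : IsDiagramSupport o d 0 :=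
  ⟨⟨0, isRowSupport_zero 0⟩, fun _ _ _ _ _ h => (h rfl).elim, fun _ => zero_le_one⟩

theorem isDiagramSupport_of_mem_innerPart (h : β ∈ innerPart o d) :
    IsDiagramSupport o d β ∧ β 1 ≠ 0 := by
  obtain ⟨r, hr, rfl⟩ := exists_component_of_mem_innerPart h
  exact ⟨isDiagramSupport_component r 1, component_self hr⟩

theorem IsDiagramSupport.thinExtVanishes (hβ : IsDiagramSupport o d β)
    (hγ : IsDiagramSupport o d γ) : ThinExtVanishes (typeA o) β γ :=
  thinExtVanishes_of_isRowSupport hβ.1.choose_spec hγ.1.choose_spec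

theorem isRigidList_procedureD (o : Fin (k + 2) → Bool) (d : Fin (k + 3) → ℕ) (c : ℕ) :
    IsRigidList (typeD o true) (procedureD o d c) := by
  have hfirst : ∀ β ∈ firstClass o d, β ∈ innerPart o d ∧ β 0 = if o 0 then 1 else 0 := by
    intro β hβ
    simpa [firstClass] using hβ
  have hsecond : ∀ β ∈ secondClass o d, β ∈ innerPart o d ∧ β 0 = if o 0 then 0 else 1 := by
    intro β hβ
    simpa [secondClass] using hβ
  have hmid : ∀ v ∈ middleRows o d c, IsDiagramSupport o d v := by
    intro v hv
    rcases mem_middleRows hv with rfl | hv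
    · exact isDiagramSupport_zero
    · exact (isDiagramSupport_of_mem_innerPart (hfirst v hv).1).1
  obtain ⟨P, hP1, hP2, hP3, hP4⟩ := exists_rows_moveSecondClass (o := o)
    (middleRows o d c).reverse (secondClass o d) (pairwise_middleRows o d c)
    (pairwise_secondClass o d)
    (fun w hw => by
      obtain ⟨h1, h2⟩ := isDiagramSupport_of_mem_innerPart (hsecond w hw).1
      exact thinHomAt_of_le le_rfl h1.1.choose_spec h1.1.choose_spec h1.2.1 h1.2.1 h2 h2 Iff.rfl)
    (fun w hw v hv h => by
      rw [List.mem_reverse] at hv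
      obtain ⟨h1, h2⟩ := isDiagramSupport_of_mem_innerPart (hsecond w hw).1
      have h3 := hmid v hv
      refine thinHomAt_of_hasNonzeroHom h1.2.2 h3.2.2 h1.2.1 h3.2.1 h2 (fun h0 => ?_) ?_ h
      · exact (isDiagramSupport_of_mem_innerPart
          (hfirst v ((mem_middleRows hv).resolve_left h0)).1).2
      -- Components of different classes are never both non-zero at vertex `1`.
      · rcases mem_middleRows hv with rfl | hv
        · exact Or.inr rfl
        · have h4 := (hfirst v hv).2
          have h5 := (hsecond w hw).2
          split_ifs at h4 h5 <;> tauto)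
  set singles := outerPart o d ++ (moveSecondClass o (middleRows o d c).reverse
    (secondClass o d)).2 ++ (firstClass o d).drop c with hsingles
  have hS : ∀ β ∈ singles, IsDiagramSupport o d β ∧ (∃ i, β i ≠ 0) ∧
      ∀ p ∈ P, IsAbsorbedBy o (rowSupport p) β := by
    intro β hβ
    rw [hsingles, List.mem_append, List.mem_append] at hβ
    rcases hβ with (hβ | hβ) | hβ
    · simp only [outerPart, List.mem_filter, decide_eq_true_eq] at hβ
      obtain ⟨r, p, hp, rfl⟩ := exists_component_of_mem_diagramA hβ.1
      exact ⟨isDiagramSupport_component r p, ⟨p, component_self hp⟩, fun _ _ => Or.inl hβ.2⟩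
    · obtain ⟨h1, h2⟩ := hP3 β hβ
      obtain ⟨h3, h4⟩ := isDiagramSupport_of_mem_innerPart (hsecond β h1).1
      exact ⟨h3, ⟨1, h4⟩, h2⟩
    · obtain ⟨h3, h4⟩ := isDiagramSupport_of_mem_innerPart (hfirst β (List.mem_of_mem_drop hβ)).1
      exact ⟨h3, ⟨1, h4⟩, fun p hp => isAbsorbedBy_rowSupport_left
        (thinHomAt_of_mem_drop hβ (List.mem_reverse.mp (hP2 p hp).1))⟩
  have hrow : ∀ p ∈ P, ∀ b, IsDiagramSupport o d (rowSupport p b) := by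
    intro p hp b
    obtain ⟨h1, h2⟩ := hP2 p hp
    cases b with
    | true => exact hmid _ (List.mem_reverse.mp h1)
    | false =>
      change IsDiagramSupport o d p.2
      rcases h2 with h2 | h2
      · rw [h2]
        exact isDiagramSupport_zero
      · exact (isDiagramSupport_of_mem_innerPart (hsecond _ h2.1).1).1
  have hsingle : ∀ β ∈ singles, ∀ b,
      IsDiagramSupport o d ((fun b : Bool => if b then β else 0) b) := by
    intro β hβ b
    cases b with
    | true => exact (hS β hβ).1
    | false => exact isDiagramSupport_zero
  refine ⟨singles.map (fun β => pairRep o (fun b => if b then β else 0) 0) ++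
    P.map (fun p => pairRep o (rowSupport p) 1), ?_, ?_, ?_⟩
  · rw [List.map_append, List.map_map, List.map_map, procedureD]
    refine congrArg₂ _ (List.map_congr_left fun β hβ => ?_) ?_
    · rw [Function.comp_apply, dimVector_pairRep (fun b => (hsingle β hβ b).2.2) zero_le_one]
      simp
    · rw [← hP1, List.map_map]
      refine List.map_congr_left fun p hp => ?_
      rw [Function.comp_apply, dimVector_pairRep (fun b => (hrow p hp b).2.2) le_rfl]
      rfl
  · intro M hM
    rw [List.mem_append, List.mem_map, List.mem_map] at hM
    rcases hM with ⟨β, hβ, rfl⟩ | ⟨p, hp, rfl⟩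
    · exact isBrick_pairRep_zero (hS β hβ).1.2.1.isThinBrick (hS β hβ).2.1
    · have hp1 : p.1 = 0 ∨ p.1 ∈ firstClass o d :=
        mem_middleRows (List.mem_reverse.mp (hP2 p hp).1)
      have hp2 := (hP2 p hp).2
      refine isBrick_pairRep_one (fun b => (hrow p hp b).2.1.isThinBrick) ?_ ?_
      · intro b i hi
        cases b with
        | true =>
          rcases hp1 with h0 | h0
          · exact (hi (congrFun h0 i)).elim
          · exact (isDiagramSupport_of_mem_innerPart (hfirst _ h0).1).2
        | false =>
          rcases hp2 with h0 | h0
          · exact (hi (congrFun h0 i)).elim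
          · exact (isDiagramSupport_of_mem_innerPart (hsecond _ h0.1).1).2
      · intro b f hf i hi hi'
        have hv : p.1 ≠ 0 := by
          rintro h0
          cases b
          · exact hi' (congrFun h0 i)
          · exact hi (congrFun h0 i)
        have hw : p.2 ≠ 0 := by
          rintro h0
          cases b
          · exact hi (congrFun h0 i)
          · exact hi' (congrFun h0 i)
        obtain ⟨h1, h1'⟩ := hfirst _ (hp1.resolve_left hv)
        obtain ⟨h2, h2'⟩ := hsecond _ (hp2.resolve_left hw).1
        cases b with
        | true =>
          refine isThinHom_eq_zero (hrow p hp true).2.1 (hrow p hp false).2.1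
            (isDiagramSupport_of_mem_innerPart h1).2 (isDiagramSupport_of_mem_innerPart h2).2
            ?_ hf hi hi'
          change if o 0 then p.1 0 ≠ 0 ∧ p.2 0 = 0 else p.1 0 = 0 ∧ p.2 0 ≠ 0
          rw [h1', h2']
          split_ifs <;> simp
        | false =>
          -- From the second class to the first, vanishing is the failure of stop rule (c) at the
          -- moment of the move.
          exact isThinHom_zero_of_not_hasNonzeroHom (hrow p hp false).2.2 (hrow p hp true).2.2
            (hp2.resolve_left hw).2 hf hi hi'
  · intro M hM N hN
    rw [List.mem_append, List.mem_map, List.mem_map] at hM hN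
    rcases hM with ⟨β, hβ, rfl⟩ | ⟨p, hp, rfl⟩ <;> rcases hN with ⟨γ, hγ, rfl⟩ | ⟨q, hq, rfl⟩
    · exact extVanishes_pairRep (fun b b' => (hsingle β hβ b).thinExtVanishes (hsingle γ hγ b'))
        fun h => (h rfl).elim
    · exact extVanishes_pairRep (fun b b' => (hsingle β hβ b).thinExtVanishes (hrow q hq b'))
        fun _ => ⟨true, Or.inr ((hS β hβ).2.2 q hq), Or.inl rfl⟩
    · exact extVanishes_pairRep (fun b b' => (hrow p hp b).thinExtVanishes (hsingle γ hγ b'))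
        fun h => (h rfl).elim
    · obtain ⟨b, hb⟩ := hP4 p hp q hq
      exact extVanishes_pairRep (fun b b' => (hrow p hp b).thinExtVanishes (hrow q hq b'))
        -- The label `b` is absorbed; the other one is taken care of by the scalar at `n`.
        fun _ => ⟨!b, Or.inl one_ne_zero, by rwa [Bool.not_not]⟩

/-! ### Dimension counts for the procedure -/

theorem List.sum_filter_add_sum_filter_not {M : Type} [AddCommMonoid M] (l : List M)
    (q : M → Bool) : (l.filter q).sum + (l.filter fun x => !q x).sum = l.sum := by
  induction l with
  | nil => simp
  | cons a l ih =>
    rw [List.sum_cons, ← ih]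
    cases h : q a
    · simp only [List.filter_cons, h, Bool.false_eq_true, if_false, Bool.not_false, if_true,
        List.sum_cons]
      abel
    · simp only [List.filter_cons, h, Bool.false_eq_true, if_false, Bool.not_true, if_true,
        List.sum_cons]
      abel

/-- The default value `0` makes this valid also when `c` exceeds the length, that is, when rows stay
empty. -/
theorem List.sum_range_getD_add_sum_drop {M : Type} [AddCommMonoid M] (l : List M) (c : ℕ) :
    ((List.range c).map fun j => l.getD j 0).sum + (l.drop c).sum = l.sum := by
  induction c with
  | zero => simp
  | succ c ih =>
    rw [← ih, List.range_succ, List.map_append, List.sum_append, add_assoc]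
    congr 1
    rcases lt_or_ge c l.length with h | h
    · rw [List.drop_eq_getElem_cons h, List.sum_cons, List.map_singleton, List.sum_singleton,
        List.getD_eq_getElem _ _ h]
    · rw [List.drop_eq_nil_of_le h, List.drop_eq_nil_of_le (h.trans c.le_succ),
        List.map_singleton, List.sum_singleton, List.getD_eq_default _ _ h, zero_add]

/-- The components through vertex `2` are listed by rows in `innerPart` and by leftmost dots in
`diagramA`; `sum_diagramA` compares the two sums. -/
theorem innerPart_sum_add_outerPart_sum (o : Fin (k + 2) → Bool) (d : Fin (k + 3) → ℕ) :
    (outerPart o d).sum + (innerPart o d).sum = d := by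
  conv_rhs => rw [← diagramA_sum o d, ← List.sum_filter_add_sum_filter_not _ (fun β => β 1 = 0)]
  rw [outerPart]
  congr 1
  ext j
  rw [List.sum_apply', List.sum_apply', innerPart, List.map_map]
  refine (sum_diagramA (o := o) (d := d) (fun β => β j) 1).symm.trans ?_
  induction diagramA o d with
  | nil => rfl
  | cons β l ih =>
    by_cases h : β 1 = 0 <;> simp_all

theorem firstClass_sum_add_secondClass_sum (o : Fin (k + 2) → Bool) (d : Fin (k + 3) → ℕ) :
    (firstClass o d).sum + (secondClass o d).sum = (innerPart o d).sum := by
  rw [← List.sum_filter_add_sum_filter_not (innerPart o d)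
    (fun β => β 0 = if o 0 then 1 else 0), firstClass, secondClass]
  congr 2
  -- Dimensions at vertex `1` are zero or one, so the two filters are complementary.
  refine List.filter_congr fun β hβ => ?_
  obtain ⟨r, -, rfl⟩ := exists_component_of_mem_innerPart hβ
  have := component_le_one (o := o) (d := d) r 1 0
  rw [← decide_not, decide_eq_decide]
  split_ifs <;> omega

theorem List.sum_map_snoc (l : List (Fin (k + 3) → ℕ)) (a : ℕ) :
    (l.map fun β => Fin.snoc (α := fun _ => ℕ) β a).sum =
      Fin.snoc (α := fun _ => ℕ) l.sum (l.length * a) := by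
  induction l with
  | nil =>
    ext x
    induction x using Fin.lastCases <;> simp
  | cons β l ih =>
    rw [List.map_cons, List.sum_cons, ih]
    ext x
    induction x using Fin.lastCases <;> simp [add_mul, add_comm]

theorem procedureD_sum (o : Fin (k + 2) → Bool) (d : Fin (k + 3) → ℕ) (c : ℕ) :
    (procedureD o d c).sum = Fin.snoc (α := fun _ => ℕ) d c := by
  have h1 := moveSecondClass_sum (o := o) (middleRows o d c).reverse (secondClass o d)
  have h2 := moveSecondClass_length (o := o) (middleRows o d c).reverse (secondClass o d)
  have h3 : (middleRows o d c).sum + _ = _ := List.sum_range_getD_add_sum_drop (firstClass o d) c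
  rw [List.sum_reverse] at h1
  rw [List.length_reverse, middleRows, List.length_map, List.length_range, ← middleRows] at h2
  rw [procedureD, List.sum_append, List.sum_map_snoc, List.sum_map_snoc, h2]
  ext x
  induction x using Fin.lastCases with
  | last => simp
  | cast i =>
    have h4 := congrFun h1 i
    have h5 := congrFun h3 i
    have h6 := congrFun (innerPart_sum_add_outerPart_sum o d) i
    have h7 := congrFun (firstClass_sum_add_secondClass_sum o d) i
    simp only [Pi.add_apply, List.sum_append, Fin.snoc_castSucc] at *
    omega

end ProcedureProof

theorem typeD_not_eq_op {k : ℕ} (o : Fin (k + 2) → Bool) :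
    (typeD (fun i => !(o i)) true).op = typeD o false := by
  have h1 : ∀ a, (typeD (fun i => !(o i)) true).head a = (typeD o false).tail a := by
    rintro (e | ⟨⟩)
    · cases h : o e <;> simp [typeD, typeA, h]
    · rfl
  have h2 : ∀ a, (typeD (fun i => !(o i)) true).tail a = (typeD o false).head a := by
    rintro (e | ⟨⟩)
    · cases h : o e <;> simp [typeD, typeA, h]
    · rfl
  exact congrArg₂ QuiverData.mk (funext h1) (funext h2)

theorem mainTheorem12 (k : ℕ) (o : Fin (k + 2) → Bool) (s : Bool) (α : Fin (k + 4) → ℕ) :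
    IsGenericDecomposition (typeA o) (Fin.init (α := fun _ => ℕ) α)
        (diagramA o (Fin.init (α := fun _ => ℕ) α)) ∧
      IsGenericDecomposition (typeD o s) α (genericDecompositionD o s α) := by
  refine ⟨(isRigidList_diagramA o _).isGenericDecomposition (diagramA_sum o _), ?_⟩
  have hsum : (genericDecompositionD o s α).sum = α := by
    rw [genericDecompositionD, procedureD_sum]
    exact Fin.snoc_init_self α
  refine IsRigidList.isGenericDecomposition ?_ hsum
  cases s with
  | true => exact isRigidList_procedureD _ _ _
  | false =>
    -- Duality carries the rigid list of the opposite quiver over with the same dimension vectors.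
    rw [← typeD_not_eq_op]
    exact (isRigidList_procedureD _ _ _).op
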